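/- Let $\ell\ge 1$ be a constant and let $a_1\ge a_2\ge\dots\ge a_\ell>0$ be fixed rational numbers. Let $\mathcal R$ be the positional scoring rule with scoring vector $(a_1,a_2,\dots,a_\ell,0,\dots,0)$: in an election in which every voter has a strict linear order over the candidates, each voter gives $a_i$ points to the candidate at position $i$ of her list for $i\le\ell$ and $0$ points to every other candidate (an election with $t<\ell$ candidates uses only $a_1,\dots,a_t$), and the winners are all candidates with the maximum total score. In the problem Necessary President for $\mathcal R$ the input $I$ consists of an election with a finite candidate set $C$ and a finite voter set $V$, a partition of $C$ into nonempty parties, and a distinguished candidate $p\in C$; the question is whether, for every set $C'\subseteq C$ that contains $p$ and exactly one candidate of each party, $p$ is among the winners under $\mathcal R$ of the election obtained by restricting all preferences to $C'$. Then Necessary President for $\mathcal R$ is fixed-parameter tractable when parameterized by the number $\tau$ of voter types, that is, of distinct preference orders that occur among the voters: there are a computable function $f$, a constant $d$ and an algorithm that decides every instance $I$ in time at most $f(\tau)\cdot|I|^{d}$, where $|I|$ is the length of the encoding of $I$. -/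

import Mathlib

/-! ## Algorithms: WHILE programs over binary trees, with running times

The machine model is the textbook WHILE language of Jones: finitely many variables hold binary
trees, the elementary operations build a pair, take it apart, and test for `nil`, and each of them
costs one time unit. With trees represented by pointers every elementary operation takes constant
time on a random access machine, and WHILE programs, random access machines and multitape Turing
machines simulate each other with polynomial overhead; in particular "time
`f k * |I| ^ O(1)` for some computable `f`" means the same in these models. -/

namespace WhileLang

/-- The data of the language: finite binary trees. -/
inductive Data : Type where
  | nil : Data
  | cons (a b : Data) : Data

/-- The head of a tree (`nil` has head `nil`). -/
def Data.hd : Data → Data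
  | .nil => .nil
  | .cons a _ => a

/-- The tail of a tree (`nil` has tail `nil`). -/
def Data.tl : Data → Data
  | .nil => .nil
  | .cons _ b => b

/-- The number of nodes of a tree. -/
def Data.size : Data → ℕ
  | .nil => 1
  | .cons a b => a.size + b.size + 1

/-- Lists as trees. -/
def Data.ofList : List Data → Data
  | [] => .nil
  | x :: xs => .cons x (Data.ofList xs)

/-- Truth values as trees. -/
def Data.ofBool : Bool → Data
  | false => .nil
  | true => .cons .nil .nil

/-- Natural numbers as trees: the list of binary digits. -/
def Data.ofNat (k : ℕ) : Data :=
  Data.ofList (k.bits.map Data.ofBool)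

/-- Expressions over the variables `0, 1, 2, …`. -/
inductive Expr : Type where
  | var (x : ℕ) : Expr
  | nil : Expr
  | cons (e₁ e₂ : Expr) : Expr
  | hd (e : Expr) : Expr
  | tl (e : Expr) : Expr

/-- Commands. -/
inductive Cmd : Type where
  /-- `x := e` -/
  | assign (x : ℕ) (e : Expr) : Cmd
  /-- `c₁ ; c₂` -/
  | seq (c₁ c₂ : Cmd) : Cmd
  /-- `if e ≠ nil then c₁ else c₂` -/
  | ite (e : Expr) (c₁ c₂ : Cmd) : Cmd
  /-- `while e ≠ nil do c` -/
  | loop (e : Expr) (c : Cmd) : Cmd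

/-- A store assigns a tree to each variable. -/
abbrev Store : Type := ℕ → Data

/-- The value of an expression. -/
def Expr.eval (s : Store) : Expr → Data
  | .var x => s x
  | .nil => .nil
  | .cons e₁ e₂ => .cons (e₁.eval s) (e₂.eval s)
  | .hd e => (e.eval s).hd
  | .tl e => (e.eval s).tl

/-- The time to evaluate an expression: one unit for each operation in it. -/
def Expr.cost : Expr → ℕ
  | .var _ => 1
  | .nil => 1
  | .cons e₁ e₂ => e₁.cost + e₂.cost + 1
  | .hd e => e.cost + 1
  | .tl e => e.cost + 1

/-- `Exec c s s' t`: started in the store `s`, the command `c` terminates after exactly `t` time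
units, in the store `s'`. -/
inductive Exec : Cmd → Store → Store → ℕ → Prop where
  | assign (x : ℕ) (e : Expr) (s : Store) :
      Exec (.assign x e) s (Function.update s x (e.eval s)) (e.cost + 1)
  | seq {c₁ c₂ : Cmd} {s s' s'' : Store} {t₁ t₂ : ℕ} :
      Exec c₁ s s' t₁ → Exec c₂ s' s'' t₂ → Exec (.seq c₁ c₂) s s'' (t₁ + t₂ + 1)
  | iteTrue {e : Expr} {c₁ c₂ : Cmd} {s s' : Store} {t : ℕ} :
      e.eval s ≠ .nil → Exec c₁ s s' t → Exec (.ite e c₁ c₂) s s' (e.cost + t + 1)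
  | iteFalse {e : Expr} {c₁ c₂ : Cmd} {s s' : Store} {t : ℕ} :
      e.eval s = .nil → Exec c₂ s s' t → Exec (.ite e c₁ c₂) s s' (e.cost + t + 1)
  | loopTrue {e : Expr} {c : Cmd} {s s' s'' : Store} {t₁ t₂ : ℕ} :
      e.eval s ≠ .nil → Exec c s s' t₁ → Exec (.loop e c) s' s'' t₂ →
        Exec (.loop e c) s s'' (e.cost + t₁ + t₂ + 1)
  | loopFalse {e : Expr} {c : Cmd} {s : Store} :
      e.eval s = .nil → Exec (.loop e c) s s (e.cost + 1)

/-- The initial store: the input is in variable `0`, all other variables are `nil`. -/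
def inputStore (d : Data) : Store :=
  Function.update (fun _ => Data.nil) 0 d

/-- On input `d` the program halts within `T` time units, and it answers "yes" (a tree other than
`nil` in variable `0`) if and only if `answer` holds. -/
def DecidesWithin (c : Cmd) (d : Data) (answer : Prop) (T : ℕ) : Prop :=
  ∃ (s' : Store) (t : ℕ), Exec c (inputStore d) s' t ∧ t ≤ T ∧ (s' 0 ≠ Data.nil ↔ answer)

end WhileLang

/-- A parameterized decision problem: its instances with their encoding as inputs, the question,
and the parameter. -/
structure ParameterizedProblem where
  /-- the instances -/
  Instance : Type
  /-- the input that represents an instance -/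
  encode : Instance → WhileLang.Data
  /-- the yes-instances -/
  IsYes : Instance → Prop
  /-- the parameter of an instance -/
  param : Instance → ℕ

/-- Fixed-parameter tractability: one algorithm decides all instances `I` in time
`f k * |I| ^ d`, where `k` is the parameter of `I`, `f` is a computable function and `d` is a
constant. -/
def ParameterizedProblem.IsFPT (Q : ParameterizedProblem) : Prop :=
  ∃ (c : WhileLang.Cmd) (f : ℕ → ℕ) (d : ℕ), Computable f ∧
    ∀ I : Q.Instance,
      WhileLang.DecidesWithin c (Q.encode I) (Q.IsYes I)
        (f (Q.param I) * (Q.encode I).size ^ d)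

/-! ## Elections and positional scoring rules -/

/-- An election with candidate set `C` and voter set `V`: each voter has a strict linear order
over the candidates, `pref v c d` meaning that `v` prefers `c` to `d`. -/
structure Election (C V : Type) where
  /-- the preferences of the voters -/
  pref : V → C → C → Prop
  /-- preferences are strict linear orders -/
  strict : ∀ v, IsStrictTotalOrder C (pref v)

namespace Election

variable {C V : Type}

/-- The reduced election over a set `C'` of nominees: preferences are restricted to `C'`. -/
def reduced (E : Election C V) (C' : Finset C) : Election C' V where
  pref v c d := E.pref v c d
  strict v :=
    haveI := E.strict v
    { trichotomous := fun c d h₁ h₂ =>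
        Subtype.ext (Std.Trichotomous.trichotomous (r := E.pref v) (c : C) d h₁ h₂)
      irrefl := fun c => irrefl_of (E.pref v) (c : C)
      trans := fun _ _ _ h₁ h₂ => trans_of (E.pref v) h₁ h₂ }

/-- The number of voter types, i.e. of distinct preferences that occur among the voters. -/
noncomputable def numTypes (E : Election C V) : ℕ :=
  (Set.range E.pref).ncard

/-- The position of candidate `c` in the preference list of voter `v`, counted from `0`. -/
noncomputable def position (E : Election C V) (v : V) (c : C) : ℕ :=
  {d : C | E.pref v d c}.ncard

/-- The score of `c` when each voter gives `a i` points to the candidate at position `i`. -/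
noncomputable def score [Fintype V] (E : Election C V) (a : ℕ → ℚ) (c : C) : ℚ :=
  ∑ v, a (E.position v c)

end Election

/-- A voting rule assigns a set of winners to every election. -/
abbrev VotingRule : Type 1 :=
  ∀ (C V : Type) [Fintype C] [Fintype V], Election C V → Set C

/-- The positional scoring rule of the scoring vector `a`: winners are the candidates of maximum
score. (Elections with `t` candidates use the first `t` entries of `a`.) -/
def scoringRule (a : ℕ → ℚ) : VotingRule :=
  fun _ _ _ _ E => {c | ∀ d, E.score a d ≤ E.score a c}

/-- The scoring vector `(a₁, …, a_ℓ, 0, 0, …)`. -/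
def shortVector {l : ℕ} (a : Fin l → ℚ) (i : ℕ) : ℚ :=
  if h : i < l then a ⟨i, h⟩ else 0

/-! ## The problem Necessary President -/

/-- An instance of Necessary President: an election with its candidates and voters numbered, a
partition of the candidates into parties, and a distinguished candidate. -/
structure NPInstance where
  /-- number of candidates -/
  n : ℕ
  /-- number of voters -/
  m : ℕ
  /-- number of parties -/
  t : ℕ
  /-- the preference lists: `ballot v i` is the candidate at position `i` for voter `v` -/
  ballot : Fin m → Fin n ≃ Fin n
  /-- the party of each candidate -/
  party : Fin n → Fin t
  /-- parties are nonempty -/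
  party_surjective : Function.Surjective party
  /-- the distinguished candidate -/
  p : Fin n

namespace NPInstance

/-- The election of an instance: `v` prefers `c` to `d` if `c` stands before `d` in the list of
`v`. -/
def election (I : NPInstance) : Election (Fin I.n) (Fin I.m) where
  pref v c d := (I.ballot v).symm c < (I.ballot v).symm d
  strict v :=
    { trichotomous := fun _ _ h₁ h₂ =>
        (I.ballot v).symm.injective (le_antisymm (not_lt.mp h₂) (not_lt.mp h₁))
      irrefl := fun _ => lt_irrefl _
      trans := fun _ _ _ => lt_trans }

/-- `C'` arises when each party nominates exactly one of its candidates. -/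
def IsNomination (I : NPInstance) (C' : Finset (Fin I.n)) : Prop :=
  ∀ j : Fin I.t, ∃! c, c ∈ C' ∧ I.party c = j

/-- The distinguished candidate is a necessary president under the voting rule `R`: it wins every
reduced election over a set of nominees that contains it. -/
def IsNecessaryPresident (R : VotingRule) (I : NPInstance) : Prop :=
  ∀ (C' : Finset (Fin I.n)) (hp : I.p ∈ C'), I.IsNomination C' →
    (⟨I.p, hp⟩ : C') ∈ R C' (Fin I.m) (I.election.reduced C')

/-- The input that represents an instance: the distinguished candidate, the list of all
candidates with their parties, and the list of the preference lists of all voters; candidates and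
parties are given by their numbers in binary. -/
def encode (I : NPInstance) : WhileLang.Data :=
  .cons (.ofNat I.p)
    (.cons
      (.ofList (List.ofFn fun c : Fin I.n =>
        WhileLang.Data.cons (.ofNat c) (.ofNat (I.party c))))
      (.ofList (List.ofFn fun v : Fin I.m =>
        WhileLang.Data.ofList (List.ofFn fun i : Fin I.n =>
          WhileLang.Data.ofNat (I.ballot v i)))))

end NPInstance

/-- Necessary President for the voting rule `R`, parameterized by the number of voter types. -/
noncomputable def necessaryPresidentByTypes (R : VotingRule) : ParameterizedProblem where
  Instance := NPInstance
  encode := NPInstance.encode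
  IsYes := NPInstance.IsNecessaryPresident R
  param I := I.election.numTypes

/-!
The presidency of `p` fails exactly if some nomination that contains `p` also contains a candidate
`c` of greater score. Fix `c`. The two scores depend only on how many nominees each voter prefers
to `p` and to `c`, and these numbers matter only up to the constant length `ℓ` of the scoring
vector. Hence a dynamic program decides whether such a nomination exists: it goes through the
parties and keeps the set of all truncated vectors of counts that the choices made so far can
produce. Voters of the same type always have the same counts, so that there are never more than
`(ℓ + 1) ^ (2 * τ)` vectors, where `τ` is the number of types. It is enough to keep the counts voter
by voter and to delete duplicates; the types need not be computed.

A count is stored as the rest of the scoring vector from the current position on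
(`NPInstance.State`). Counting one more preferred nominee means taking the tail, the truncation at
`ℓ` is automatic because the tail of the empty list is empty, and in the end the head is the number
of points. The scores are multiplied by a common denominator and written in unary
(`exists_unary_scores`). `NPInstance.alwaysWins_iff` is the correctness of the dynamic program, and
`NPInstance.length_outcomes_le` the bound on the number of vectors.

To obtain a WHILE program with its running time, the predicate `WhileLang.Feasible` says that a
function between encoded types is computed by a program within time polynomial in a weight of the
argument. Feasible functions are closed under composition, case distinction and folds over lists
whose accumulator stays polynomially bounded (`WhileLang.Feasible.foldl`), so that feasibility of
the dynamic program follows the structure of its definition. The weight of an instance `I` is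
`|I| * 2 ^ τ`: the number of vectors is polynomial in it, and a polynomial in it has the form
`f τ * |I| ^ d`.
-/

namespace WhileLang

/-! ### Executions with a time budget -/

/-- Started in `s`, the command `c` halts within `T` time units in a store that satisfies `Q`. -/
def Runs (c : Cmd) (s : Store) (T : ℕ) (Q : Store → Prop) : Prop :=
  ∃ s' t, Exec c s s' t ∧ t ≤ T ∧ Q s'

theorem Runs.mono {c : Cmd} {s : Store} {T T' : ℕ} {Q Q' : Store → Prop}
    (h : Runs c s T Q) (hT : T ≤ T') (hQ : ∀ s', Q s' → Q' s') : Runs c s T' Q' := by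
  obtain ⟨s', t, he, ht, hq⟩ := h
  exact ⟨s', t, he, ht.trans hT, hQ _ hq⟩

theorem Runs.assign {x : ℕ} {e : Expr} {s : Store} {Q : Store → Prop}
    (h : Q (Function.update s x (e.eval s))) : Runs (.assign x e) s (e.cost + 1) Q :=
  ⟨_, _, .assign x e s, le_rfl, h⟩

theorem Runs.seq {c₁ c₂ : Cmd} {s : Store} {T₁ T₂ : ℕ} {Q : Store → Prop}
    (h : Runs c₁ s T₁ fun s' => Runs c₂ s' T₂ Q) : Runs (.seq c₁ c₂) s (T₁ + T₂ + 1) Q := by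
  obtain ⟨s', t, he, ht, s'', t', he', ht', hq⟩ := h
  exact ⟨s'', _, .seq he he', by omega, hq⟩

theorem Runs.assign_seq {x : ℕ} {e : Expr} {c : Cmd} {s : Store} {T : ℕ} {Q : Store → Prop}
    (h : Runs c (Function.update s x (e.eval s)) T Q) :
    Runs (.seq (.assign x e) c) s (T + e.cost + 2) Q :=
  (Runs.seq (Runs.assign h)).mono (by omega) fun _ => id

theorem Runs.ite_true {e : Expr} {c₁ c₂ : Cmd} {s : Store} {T : ℕ} {Q : Store → Prop}
    (he : e.eval s ≠ .nil) (h : Runs c₁ s T Q) : Runs (.ite e c₁ c₂) s (T + e.cost + 1) Q := by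
  obtain ⟨s', t, hx, ht, hq⟩ := h
  exact ⟨s', _, .iteTrue he hx, by omega, hq⟩

theorem Runs.ite_false {e : Expr} {c₁ c₂ : Cmd} {s : Store} {T : ℕ} {Q : Store → Prop}
    (he : e.eval s = .nil) (h : Runs c₂ s T Q) : Runs (.ite e c₁ c₂) s (T + e.cost + 1) Q := by
  obtain ⟨s', t, hx, ht, hq⟩ := h
  exact ⟨s', _, .iteFalse he hx, by omega, hq⟩

theorem Runs.loop_done {e : Expr} {c : Cmd} {s : Store} {Q : Store → Prop}
    (he : e.eval s = .nil) (h : Q s) : Runs (.loop e c) s (e.cost + 1) Q :=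
  ⟨s, _, .loopFalse he, le_rfl, h⟩

theorem Runs.loop_step {e : Expr} {c : Cmd} {s : Store} {T₁ T₂ : ℕ} {Q : Store → Prop}
    (he : e.eval s ≠ .nil) (h : Runs c s T₁ fun s' => Runs (.loop e c) s' T₂ Q) :
    Runs (.loop e c) s (T₁ + T₂ + e.cost + 1) Q := by
  obtain ⟨s', t, hx, ht, s'', t', hx', ht', hq⟩ := h
  exact ⟨s'', _, .loopTrue he hx hx', by omega, hq⟩

/-! ### Polynomial bounds relative to a weight -/

/-- `h` is bounded by a polynomial in `μ`. (The base is at least `2`, so that a single exponent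
absorbs constant factors.) -/
def PolyBounded {α : Type} (μ h : α → ℕ) : Prop :=
  ∃ d, ∀ x, h x ≤ (μ x + 2) ^ d

namespace PolyBounded

variable {α β : Type} {μ h h' : α → ℕ}

theorem of_le (hh : PolyBounded μ h) (le : ∀ x, h' x ≤ h x) : PolyBounded μ h' := by
  obtain ⟨d, hd⟩ := hh
  exact ⟨d, fun x => (le x).trans (hd x)⟩

theorem self : PolyBounded μ μ := ⟨1, fun x => by simp⟩

theorem const (k : ℕ) : PolyBounded μ fun _ => k :=
  ⟨k, fun x => k.lt_two_pow_self.le.trans (Nat.pow_le_pow_left (by omega) k)⟩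

theorem mul (hh : PolyBounded μ h) (hh' : PolyBounded μ h') :
    PolyBounded μ fun x => h x * h' x := by
  obtain ⟨d, hd⟩ := hh
  obtain ⟨d', hd'⟩ := hh'
  exact ⟨d + d', fun x => by rw [pow_add]; exact Nat.mul_le_mul (hd x) (hd' x)⟩

theorem add (hh : PolyBounded μ h) (hh' : PolyBounded μ h') :
    PolyBounded μ fun x => h x + h' x := by
  obtain ⟨d, hd⟩ := hh
  obtain ⟨d', hd'⟩ := hh'
  refine ⟨d + d' + 1, fun x => ?_⟩
  have h1 : (μ x + 2) ^ d ≤ (μ x + 2) ^ (d + d') := Nat.pow_le_pow_right (by omega) (by omega)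
  have h2 : (μ x + 2) ^ d' ≤ (μ x + 2) ^ (d + d') := Nat.pow_le_pow_right (by omega) (by omega)
  have h3 := hd x
  have h4 := hd' x
  rw [pow_succ]
  nlinarith [Nat.zero_le (μ x * (μ x + 2) ^ (d + d'))]

theorem pow (hh : PolyBounded μ h) (k : ℕ) : PolyBounded μ fun x => h x ^ k := by
  obtain ⟨d, hd⟩ := hh
  exact ⟨d * k, fun x => by rw [pow_mul]; exact Nat.pow_le_pow_left (hd x) k⟩

/-- A polynomial in a polynomially bounded weight is polynomially bounded. -/
theorem comp {ν g : β → ℕ} (hg : PolyBounded ν g) {f : α → β}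
    (hf : PolyBounded μ fun x => ν (f x)) : PolyBounded μ fun x => g (f x) := by
  obtain ⟨d, hd⟩ := hg
  exact ((hf.add (const 2)).pow d).of_le fun x => hd (f x)

end PolyBounded

/-! ### Encoded types -/

/-- A type whose elements are represented by trees. -/
class Encoding (α : Type) where
  /-- the tree that represents an element -/
  enc : α → Data

open Encoding (enc)

/-- A type of inputs, each with a weight that bounds the size of its encoding. Running times are
measured in terms of the weight, which may be larger than the size: this leaves room for a factor
that depends on the parameter. -/
class Context (Γ : Type) extends Encoding Γ where
  /-- the quantity in which running times are measured -/
  weight : Γ → ℕ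
  size_le : ∀ x, (enc x).size ≤ weight x

open Context (weight)

variable {Γ α β δ : Type}

instance : Encoding Data := ⟨id⟩
instance : Encoding Unit := ⟨fun _ => .nil⟩
instance : Encoding Bool := ⟨Data.ofBool⟩
/-- Numbers are encoded in binary; numbers in unary are represented as `List Unit`. -/
instance : Encoding ℕ := ⟨Data.ofNat⟩
instance [Encoding α] [Encoding β] : Encoding (α × β) := ⟨fun x => .cons (enc x.1) (enc x.2)⟩
instance [Encoding α] : Encoding (List α) := ⟨fun l => Data.ofList (l.map enc)⟩

/-- A value that is added to the context contributes its size to the weight. -/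
instance [Context Γ] [Encoding α] : Context (Γ × α) where
  toEncoding := inferInstance
  weight x := weight x.1 + (enc x.2).size + 1
  size_le x := by
    have := Context.size_le x.1
    change (Data.cons (enc x.1) (enc x.2)).size ≤ _
    simp only [Data.size]
    omega

@[simp] theorem enc_pair [Encoding α] [Encoding β] (a : α) (b : β) :
    enc (a, b) = Data.cons (enc a) (enc b) := rfl

@[simp] theorem enc_nil [Encoding α] : enc ([] : List α) = Data.nil := rfl

@[simp] theorem enc_cons [Encoding α] (a : α) (l : List α) :
    enc (a :: l) = Data.cons (enc a) (enc l) := rfl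

@[simp] theorem enc_true : enc true = Data.cons .nil .nil := rfl

@[simp] theorem enc_false : enc false = Data.nil := rfl

theorem weight_pair [Context Γ] [Encoding α] (x : Γ) (a : α) :
    weight (x, a) = weight x + (enc a).size + 1 := rfl

theorem size_enc_bool_le (b : Bool) : (enc b).size ≤ 3 := by
  cases b <;> simp [Data.size]

theorem size_enc_le_of_mem [Encoding α] {l : List α} {a : α} (h : a ∈ l) :
    (enc a).size ≤ (enc l).size := by
  induction l with
  | nil => cases h
  | cons b l ih =>
    simp only [enc_cons, Data.size]
    rcases List.mem_cons.mp h with rfl | h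
    · omega
    · have := ih h
      omega

theorem length_le_size_enc [Encoding α] (l : List α) : l.length ≤ (enc l).size := by
  induction l with
  | nil => simp
  | cons b l ih =>
    simp only [enc_cons, Data.size, List.length_cons]
    omega

theorem size_enc_list_le [Encoding α] {l : List α} {M : ℕ} (h : ∀ a ∈ l, (enc a).size ≤ M) :
    (enc l).size ≤ l.length * (M + 1) + 1 := by
  induction l with
  | nil => simp [Data.size]
  | cons b l ih =>
    have h1 := ih fun a ha => h a (List.mem_cons_of_mem _ ha)
    have h2 := h b List.mem_cons_self
    simp only [enc_cons, Data.size, List.length_cons, Nat.succ_mul]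
    omega

theorem size_enc_append [Encoding α] (l l' : List α) :
    (enc (l ++ l')).size + 1 = (enc l).size + (enc l').size := by
  induction l with
  | nil => simp only [List.nil_append, enc_nil, Data.size]; omega
  | cons a l ih =>
    simp only [List.cons_append, enc_cons, Data.size]
    omega

/-! ### Feasible functions and their closure properties -/

/-- `f` is computed by a program within time polynomial in the weight of its argument, and the size
of its value is polynomial in this weight as well. The program leaves all variables beyond some
index `k` unchanged, so that larger programs can save intermediate values there. -/
def Feasible [Context Γ] [Encoding β] (f : Γ → β) : Prop :=
  ∃ (c : Cmd) (k : ℕ) (T : Γ → ℕ), PolyBounded weight T ∧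
    PolyBounded weight (fun x => (enc (f x)).size) ∧
    ∀ x s, s 0 = enc x → Runs c s (T x) fun s' => s' 0 = enc (f x) ∧ ∀ j, k < j → s' j = s j

namespace Feasible

variable [Context Γ] [Encoding α] [Encoding β] [Encoding δ]

theorem size_bound {f : Γ → β} (hf : Feasible f) :
    PolyBounded weight fun x => (enc (f x)).size := by
  obtain ⟨_, _, _, _, h, _⟩ := hf
  exact h

theorem id : Feasible fun x : Γ => x :=
  ⟨.assign 0 (.var 0), 0, fun _ => 2, .const 2, PolyBounded.self.of_le Context.size_le,
    fun x s hs => Runs.assign ⟨by simpa [Expr.eval] using hs, fun j hj => by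
      simp [Function.update_of_ne (Nat.pos_iff_ne_zero.mp hj)]⟩⟩

/-- Computing `g` in a context extended by the value of `f`. -/
theorem bind {f : Γ → β} {g : Γ × β → δ} (hf : Feasible f) (hg : Feasible g) :
    Feasible fun x => g (x, f x) := by
  obtain ⟨c, k, T, hT, hS, hc⟩ := hf
  obtain ⟨c', k', T', hT', hS', hc'⟩ := hg
  have hw : PolyBounded weight fun x => weight (x, f x) :=
    (PolyBounded.self.add hS).add (.const 1)
  refine ⟨.seq (.assign (k + 1) (.var 0)) (.seq c
    (.seq (.assign 0 (.cons (.var (k + 1)) (.var 0))) c')), k + k' + 1,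
    fun x => T x + T' (x, f x) + 9, (hT.add (hT'.comp hw)).add (.const 9), hS'.comp hw, ?_⟩
  intro x s hs
  refine (Runs.assign_seq (T := T x + (T' (x, f x) + 5) + 1) ?_).mono
    (by simp only [Expr.cost]; omega) fun _ h => h
  refine Runs.seq ((hc x _ (by simp [hs])).mono le_rfl ?_)
  rintro s₁ ⟨h0, h1⟩
  refine (Runs.assign_seq (hc' (x, f x) _ ?_)).mono (by simp [Expr.cost]) ?_
  · simp [Expr.eval, h0, h1 (k + 1) (by omega), hs]
  · rintro s₂ ⟨h2, h3⟩
    refine ⟨h2, fun j hj => ?_⟩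
    rw [h3 j (by omega), Function.update_of_ne (by omega), h1 j (by omega),
      Function.update_of_ne (by omega)]

/-- Applying an operation that a single expression computes. -/
theorem op {f : Γ → β} (hf : Feasible f) (g : β → δ) (e : Expr)
    (he : ∀ s b, s 0 = enc b → e.eval s = enc (g b)) (K : ℕ)
    (hK : ∀ b, (enc (g b)).size ≤ (enc b).size + K) : Feasible fun x => g (f x) := by
  obtain ⟨c, k, T, hT, hS, hc⟩ := hf
  refine ⟨.seq c (.assign 0 e), k, fun x => T x + (e.cost + 1) + 1,
    (hT.add (.const _)).add (.const 1), (hS.add (.const K)).of_le fun x => hK _, ?_⟩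
  intro x s hs
  refine Runs.seq ((hc x s hs).mono le_rfl ?_)
  rintro s' ⟨h1, h2⟩
  refine Runs.assign ⟨by simp [he _ _ h1], fun j hj => ?_⟩
  rw [Function.update_of_ne (by omega), h2 j hj]

theorem fst {f : Γ → α × β} (hf : Feasible f) : Feasible fun x => (f x).1 :=
  hf.op Prod.fst (.hd (.var 0)) (fun s b h => by rw [Expr.eval, Expr.eval, h]; rfl) 0 fun b => by
    obtain ⟨a, b⟩ := b
    simp only [enc_pair, Data.size]
    omega

theorem snd {f : Γ → α × β} (hf : Feasible f) : Feasible fun x => (f x).2 :=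
  hf.op Prod.snd (.tl (.var 0)) (fun s b h => by rw [Expr.eval, Expr.eval, h]; rfl) 0 fun b => by
    obtain ⟨a, b⟩ := b
    simp only [enc_pair, Data.size]
    omega

/-- Substitution: the weight of `h x` has to be polynomial in that of `x`. -/
theorem comp {Γ' : Type} [Context Γ'] {h : Γ' → Γ} {g : Γ → β} (hh : Feasible h)
    (hw : PolyBounded weight fun x => weight (h x)) (hg : Feasible g) :
    Feasible fun x => g (h x) := by
  obtain ⟨c, k, T, hT, -, hc⟩ := hh
  obtain ⟨c', k', T', hT', hS', hc'⟩ := hg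
  refine ⟨.seq c c', k + k', fun x => T x + T' (h x) + 1, (hT.add (hT'.comp hw)).add (.const 1),
    hS'.comp hw, fun x s hs => Runs.seq ((hc x s hs).mono le_rfl ?_)⟩
  rintro s₁ ⟨h1, h2⟩
  refine (hc' (h x) s₁ h1).mono le_rfl ?_
  rintro s₂ ⟨h3, h4⟩
  exact ⟨h3, fun j hj => by rw [h4 j (by omega), h2 j (by omega)]⟩

theorem polyBounded_weight_fst : PolyBounded weight fun y : Γ × α => weight y.1 :=
  PolyBounded.self.of_le fun y => by
    have : weight y = weight y.1 + (enc y.2).size + 1 := rfl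
    omega

/-- Ignoring the last entry of the context. -/
theorem weaken {f : Γ → β} (hf : Feasible f) : Feasible fun y : Γ × α => f y.1 :=
  comp id.fst polyBounded_weight_fst hf

theorem var : Feasible fun y : Γ × α => y.2 := id.snd

theorem pair {f : Γ → α} {g : Γ → β} (hf : Feasible f) (hg : Feasible g) :
    Feasible fun x => (f x, g x) :=
  hf.bind (hg.weaken.bind
    (id.op (fun y : (Γ × α) × β => (y.1.2, y.2))
      (.cons (.tl (.hd (.var 0))) (.tl (.var 0)))
      (fun s b h => by simp only [Expr.eval, h]; rfl) 0 fun b => by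
        obtain ⟨⟨x, a⟩, b⟩ := b
        simp only [enc_pair, Data.size]
        omega))

/-- Replacing the last entry of the context. -/
theorem comp_snd {f : Γ × α → β} {g : Γ × β → δ} (hg : Feasible g) (hf : Feasible f) :
    Feasible fun y => g (y.1, f y) :=
  comp (h := fun y => (y.1, f y)) (id.fst.pair hf)
    ((polyBounded_weight_fst.add hf.size_bound).add (.const 1)) hg

theorem exists_expr_eval_eq (d : Data) : ∃ e : Expr, ∀ s, e.eval s = d := by
  induction d with
  | nil => exact ⟨.nil, fun s => rfl⟩
  | cons a b iha ihb =>
    obtain ⟨e, he⟩ := iha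
    obtain ⟨e', he'⟩ := ihb
    exact ⟨.cons e e', fun s => by rw [Expr.eval, he, he']⟩

theorem const (b : β) : Feasible fun _ : Γ => b := by
  obtain ⟨e, he⟩ := exists_expr_eval_eq (enc b)
  exact id.op (fun _ => b) e (fun s _ _ => he s) (enc b).size fun _ => by omega

theorem cons {f : Γ → α} {g : Γ → List α} (hf : Feasible f) (hg : Feasible g) :
    Feasible fun x => f x :: g x :=
  (hf.pair hg).op (fun y : α × List α => y.1 :: y.2) (.var 0)
    (fun s b h => by rw [Expr.eval, h]; rfl) 0 fun b => le_rfl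

theorem tail {f : Γ → List α} (hf : Feasible f) : Feasible fun x => (f x).tail :=
  hf.op List.tail (.tl (.var 0)) (fun s l h => by rw [Expr.eval, Expr.eval, h]; cases l <;> rfl) 0
    fun l => by
      cases l
      · simp
      · simp only [List.tail_cons, enc_cons, Data.size]
        omega

/-- The head of a list of lists, with default value `[]`: here `nil` stands for both the empty list
and its head. -/
theorem headD {f : Γ → List (List α)} (hf : Feasible f) : Feasible fun x => (f x).headD [] :=
  hf.op (fun l => l.headD []) (.hd (.var 0))
    (fun s l h => by rw [Expr.eval, Expr.eval, h]; cases l <;> rfl) 0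
    fun l => by
      cases l
      · simp
      · simp only [List.headD_cons, enc_cons, Data.size]
        omega

theorem ite {b : Γ → Bool} {f g : Γ → β} (hb : Feasible b) (hf : Feasible f) (hg : Feasible g) :
    Feasible fun x => if b x then f x else g x := by
  obtain ⟨c, k, T, hT, hS, hc⟩ := hf
  obtain ⟨c', k', T', hT', hS', hc'⟩ := hg
  have hw := polyBounded_weight_fst (Γ := Γ) (α := Bool)
  refine hb.bind (g := fun y => if y.2 then f y.1 else g y.1)
    ⟨.ite (.tl (.var 0)) (.seq (.assign 0 (.hd (.var 0))) c)
      (.seq (.assign 0 (.hd (.var 0))) c'), k + k',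
    fun y => T y.1 + T' y.1 + 7, ((hT.comp hw).add (hT'.comp hw)).add (.const 7),
    ((hS.comp hw).add (hS'.comp hw)).of_le fun y => by dsimp only; split <;> omega, ?_⟩
  rintro ⟨x, b⟩ s hs
  cases b
  · refine (Runs.ite_false ?_ (Runs.assign_seq (hc' x _ ?_))).mono
      (by simp only [Expr.cost]; omega) ?_
    · simp [Expr.eval, hs, Data.tl]
    · simp [Expr.eval, hs, Data.hd]
    · rintro s' ⟨h1, h2⟩
      exact ⟨h1, fun j hj => by rw [h2 j (by omega), Function.update_of_ne (by omega)]⟩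
  · refine (Runs.ite_true ?_ (Runs.assign_seq (hc x _ ?_))).mono
      (by simp only [Expr.cost]; omega) ?_
    · simp [Expr.eval, hs, Data.tl]
    · simp [Expr.eval, hs, Data.hd]
    · rintro s' ⟨h1, h2⟩
      exact ⟨h1, fun j hj => by rw [h2 j (by omega), Function.update_of_ne (by omega)]⟩

theorem not {b : Γ → Bool} (hb : Feasible b) : Feasible fun x => !b x := by
  refine cast (congrArg _ (funext fun x => ?_)) (hb.ite (const false) (const true))
  cases b x <;> rfl

theorem and {b b' : Γ → Bool} (hb : Feasible b) (hb' : Feasible b') :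
    Feasible fun x => b x && b' x := by
  refine cast (congrArg _ (funext fun x => ?_)) (hb.ite hb' (const false))
  cases b x <;> rfl

theorem or {b b' : Γ → Bool} (hb : Feasible b) (hb' : Feasible b') :
    Feasible fun x => b x || b' x := by
  refine cast (congrArg _ (funext fun x => ?_)) (hb.ite (const true) hb')
  cases b x <;> rfl

/-! ### Loops over lists -/

/-- A left fold is feasible if its step is, and if all intermediate values of the accumulator are
polynomially bounded. -/
theorem foldl {L : Γ → List α} {b₀ : Γ → β} {step : Γ → β → α → β} (B : Γ → ℕ)
    (hB : PolyBounded weight B)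
    (hacc : ∀ x l, l <+: L x → (enc (l.foldl (step x) (b₀ x))).size ≤ B x)
    (hL : Feasible L) (hb₀ : Feasible b₀)
    (hstep : Feasible fun y : Γ × (β × α) => step y.1 y.2.1 y.2.2) :
    Feasible fun x => (L x).foldl (step x) (b₀ x) := by
  have hsize := hL.size_bound
  obtain ⟨c, k, T, ⟨d, hT⟩, -, hc⟩ := hstep
  -- The loop keeps the context in variable `k + 1`, the rest of the list in variable `k + 2`, and
  -- the accumulator in variable `0`.
  let body : Cmd := .seq (.assign 0 (.cons (.var (k + 1)) (.cons (.var 0) (.hd (.var (k + 2))))))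
    (.seq (.assign (k + 2) (.tl (.var (k + 2)))) c)
  have loop : ∀ (x : Γ) (M N : ℕ), (∀ b a, (enc b).size ≤ B x → (enc a).size ≤ M →
      T (x, b, a) ≤ N) → ∀ (l : List α) (b : β) (s : Store), s 0 = enc b → s (k + 1) = enc x →
      s (k + 2) = enc l → (∀ l', l' <+: l → (enc (l'.foldl (step x) b)).size ≤ B x) →
      (∀ a ∈ l, (enc a).size ≤ M) →
      Runs (.loop (.var (k + 2)) body) s (l.length * (N + 14) + 2) fun s' =>
        s' 0 = enc (l.foldl (step x) b) ∧ ∀ j, k + 2 < j → s' j = s j := by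
    intro x M N hN l
    induction l with
    | nil =>
      intro b s h0 h1 h2 _ _
      exact (Runs.loop_done (by simp [Expr.eval, h2]) ⟨h0, fun _ _ => rfl⟩).mono
        (by simp [Expr.cost]) fun _ => _root_.id
    | cons a l ih =>
      intro b s h0 h1 h2 hpre hM
      refine (Runs.loop_step (T₁ := N + 12) (T₂ := l.length * (N + 14) + 2)
        (by simp [Expr.eval, h2]) ?_).mono
        (by simp only [Expr.cost, List.length_cons, Nat.succ_mul]; omega) fun _ => _root_.id
      refine (Runs.assign_seq (Runs.assign_seq (hc (x, b, a) _ ?_))).mono ?_ ?_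
      · simp [Expr.eval, h0, h1, h2, Data.hd]
      · have := hN b a (hpre [] (List.nil_prefix)) (hM a List.mem_cons_self)
        simp only [Expr.cost]
        omega
      · rintro s' ⟨h3, h4⟩
        refine (ih (step x b a) s' h3 ?_ ?_ ?_ ?_).mono le_rfl ?_
        · rw [h4 _ (by omega)]
          simp [h1]
        · rw [h4 _ (by omega)]
          simp [Expr.eval, h2, Data.tl]
        · intro l' hl'
          simpa using hpre (a :: l') (by simpa using hl')
        · exact fun a' ha' => hM a' (List.mem_cons_of_mem _ ha')
        · rintro s'' ⟨h5, h6⟩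
          refine ⟨h5, fun j hj => ?_⟩
          rw [h6 j hj, h4 j (by omega), Function.update_of_ne (by omega),
            Function.update_of_ne (by omega)]
  let N : Γ → ℕ := fun x => (weight x + (B x + (enc (L x)).size + 1) + 1 + 2) ^ d
  have hN : PolyBounded weight N :=
    (((PolyBounded.self.add ((hB.add hsize).add (.const 1))).add (.const 1)).add (.const 2)).pow d
  obtain ⟨c₀, k₀, T₀, hT₀, -, hc₀⟩ := Feasible.id.pair (hL.pair hb₀)
  refine ⟨.seq c₀ (.seq (.assign (k + 1) (.hd (.var 0)))
    (.seq (.assign (k + 2) (.hd (.tl (.var 0)))) (.seq (.assign 0 (.tl (.tl (.var 0))))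
      (.loop (.var (k + 2)) body)))), k₀ + k + 2,
    fun x => T₀ x + ((enc (L x)).size * (N x + 14) + 20),
    hT₀.add ((hsize.mul (hN.add (.const 14))).add (.const 20)),
    hB.of_le fun x => hacc x _ List.prefix_rfl, ?_⟩
  intro x s hs
  have hlen := Nat.mul_le_mul_right (N x + 14) (length_le_size_enc (L x))
  refine (Runs.seq ((hc₀ x s hs).mono le_rfl ?_)).mono (T := T₀ x +
    ((L x).length * (N x + 14) + 19) + 1) (by dsimp only; omega) fun _ => _root_.id
  rintro s₁ ⟨h1, h2⟩
  refine (Runs.assign_seq (Runs.assign_seq (Runs.assign_seq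
    (loop x (enc (L x)).size (N x) ?_ (L x) (b₀ x) _ ?_ ?_ ?_ (hacc x) fun a ha =>
      size_enc_le_of_mem ha)))).mono ?_ ?_
  · intro b a hb ha
    refine (hT _).trans (Nat.pow_le_pow_left ?_ d)
    rw [weight_pair]
    simp only [enc_pair, Data.size]
    omega
  · simp [Expr.eval, h1, Data.tl]
  · simp [Expr.eval, h1, Data.hd]
  · simp [Expr.eval, h1, Data.hd, Data.tl]
  · simp only [Expr.cost]
    omega
  · rintro s₂ ⟨h3, h4⟩
    refine ⟨h3, fun j hj => ?_⟩
    rw [h4 j (by omega), Function.update_of_ne (by omega), Function.update_of_ne (by omega),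
      Function.update_of_ne (by omega), h2 j (by omega)]

end Feasible

/-! ### Equality tests -/

/-- Compares the two components of each pair on a stack of pairs of trees, which is held in
variable `1`; variable `2` holds the answer. -/
def compareLoop : Cmd :=
  .loop (.var 1)
    (.ite (.hd (.hd (.var 1)))
      (.ite (.tl (.hd (.var 1)))
        (.assign 1 (.cons (.cons (.hd (.hd (.hd (.var 1)))) (.hd (.tl (.hd (.var 1)))))
          (.cons (.cons (.tl (.hd (.hd (.var 1)))) (.tl (.tl (.hd (.var 1))))) (.tl (.var 1)))))
        (.seq (.assign 2 .nil) (.assign 1 (.tl (.var 1)))))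
      (.ite (.tl (.hd (.var 1)))
        (.seq (.assign 2 .nil) (.assign 1 (.tl (.var 1))))
        (.assign 1 (.tl (.var 1)))))

/-- The total size of the first components of a stack of pairs of trees. -/
def stackSize (l : List (Data × Data)) : ℕ := (l.map fun y => y.1.size).sum

open Classical in
/-- The loop ends because every iteration removes a node from the first components on the stack. -/
theorem compareLoop_runs (n : ℕ) (l : List (Data × Data)) (hn : stackSize l ≤ n) (r : Bool)
    (s : Store) (h1 : s 1 = enc l) (h2 : s 2 = enc r) :
    Runs compareLoop s (n * 50 + 2) fun s' =>
      s' 2 = enc (r && l.all fun y => decide (y.1 = y.2)) ∧ ∀ j, 2 < j → s' j = s j := by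
  induction n generalizing l r s with
  | zero =>
    cases l with
    | nil =>
      refine (Runs.loop_done ?_ ?_).mono (by simp [Expr.cost]) fun _ h => h
      · simp [Expr.eval, h1]
      · exact ⟨by simp [h2], fun _ _ => rfl⟩
    | cons y l =>
      obtain ⟨a, b⟩ := y
      cases a <;> simp [stackSize, Data.size] at hn
  | succ n ih =>
    cases l with
    | nil =>
      refine (Runs.loop_done ?_ ?_).mono (by simp [Expr.cost]) fun _ h => h
      · simp [Expr.eval, h1]
      · exact ⟨by simp [h2], fun _ _ => rfl⟩
    | cons y l =>
      have step : ∀ (l' : List (Data × Data)) (r' : Bool), stackSize l' ≤ n →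
          (r' && l'.all fun y => decide (y.1 = y.2)) =
            (r && (y :: l).all fun y => decide (y.1 = y.2)) → ∀ s' : Store,
          (s' 1 = enc l' ∧ s' 2 = enc r' ∧ ∀ j, 2 < j → s' j = s j) →
          Runs compareLoop s' (n * 50 + 2) fun s'' =>
            s'' 2 = enc (r && (y :: l).all fun y => decide (y.1 = y.2)) ∧
              ∀ j, 2 < j → s'' j = s j := by
        rintro l' r' hl' hr s' ⟨h3, h4, h5⟩
        refine (ih l' hl' r' s' h3 h4).mono le_rfl ?_
        rintro s'' ⟨h6, h7⟩
        exact ⟨by rw [h6, hr], fun j hj => by rw [h7 j hj, h5 j hj]⟩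
      refine (Runs.loop_step (T₁ := 40) (T₂ := n * 50 + 2) (by simp [Expr.eval, h1]) ?_).mono
        (by simp only [Expr.cost, Nat.succ_mul]; omega) fun _ => id
      have hid : ∀ d : Data, enc d = d := fun _ => rfl
      obtain ⟨a, b⟩ := y
      have upd : ∀ (d e : Data) (j : ℕ), 2 < j →
          Function.update (Function.update s 2 d) 1 e j = s j := fun d e j hj => by
        rw [Function.update_of_ne (by omega), Function.update_of_ne (by omega)]
      have upd' : ∀ (e : Data) (j : ℕ), 2 < j →
          Function.update s 1 e j = s j := fun e j hj => Function.update_of_ne (by omega) _ _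
      rcases a with _ | ⟨a, a'⟩ <;> rcases b with _ | ⟨b, b'⟩
      · refine (Runs.ite_false ?_ (Runs.ite_false ?_ (Runs.assign ?_))).mono
          (by simp [Expr.cost]) fun _ => id
        · simp [Expr.eval, h1, hid, Data.hd]
        · simp [Expr.eval, h1, hid, Data.hd, Data.tl]
        · refine step l r ?_ (by simp) _ ⟨?_, ?_, upd' _⟩
          · simp [stackSize, Data.size] at hn ⊢
            omega
          · simp [Expr.eval, h1, Data.tl]
          · simp [h2]
      · refine (Runs.ite_false ?_ (Runs.ite_true ?_ (Runs.assign_seq (Runs.assign ?_)))).mono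
          (by simp [Expr.cost]) fun _ => id
        · simp [Expr.eval, h1, hid, Data.hd]
        · simp [Expr.eval, h1, hid, Data.hd, Data.tl]
        · refine step l false ?_ (by simp) _ ⟨?_, ?_, upd _ _⟩
          · simp [stackSize, Data.size] at hn ⊢
            omega
          · simp [Expr.eval, h1, Data.tl]
          · simp [Expr.eval]
      · refine (Runs.ite_true ?_ (Runs.ite_false ?_ (Runs.assign_seq (Runs.assign ?_)))).mono
          (by simp [Expr.cost]) fun _ => id
        · simp [Expr.eval, h1, hid, Data.hd]
        · simp [Expr.eval, h1, hid, Data.hd, Data.tl]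
        · refine step l false ?_ (by simp) _ ⟨?_, ?_, upd _ _⟩
          · simp [stackSize, Data.size] at hn ⊢
            omega
          · simp [Expr.eval, h1, Data.tl]
          · simp [Expr.eval]
      · refine (Runs.ite_true ?_ (Runs.ite_true ?_ (Runs.assign ?_))).mono
          (by simp [Expr.cost]) fun _ => id
        · simp [Expr.eval, h1, hid, Data.hd]
        · simp [Expr.eval, h1, hid, Data.hd, Data.tl]
        · refine step ((a, b) :: (a', b') :: l) r ?_ ?_ _ ⟨?_, ?_, upd' _⟩
          · simp [stackSize, Data.size] at hn ⊢
            omega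
          · simp [Bool.and_assoc]
          · simp [Expr.eval, h1, hid, Data.hd, Data.tl]
          · simp [h2]

/-- Encodings that determine the encoded element. -/
class InjectiveEncoding (α : Type) extends Encoding α where
  enc_injective : Function.Injective (enc : α → Data)

open InjectiveEncoding (enc_injective)

theorem Data.ofList_injective : Function.Injective Data.ofList := by
  intro l
  induction l with
  | nil => intro l' h; cases l' <;> simp_all [Data.ofList]
  | cons a l ih =>
    intro l' h
    cases l' with
    | nil => simp [Data.ofList] at h
    | cons b l' =>
      simp only [Data.ofList, Data.cons.injEq] at h
      rw [h.1, ih h.2]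

instance : InjectiveEncoding Unit := ⟨fun _ _ _ => rfl⟩

instance : InjectiveEncoding ℕ := ⟨fun x y h => by
  have h' : x.bits = y.bits := List.map_injective_iff.mpr (fun a b hab => by
    cases a <;> cases b <;> simp_all [Data.ofBool]) (Data.ofList_injective h)
  exact Nat.eq_of_testBit_eq fun i => by rw [Nat.testBit_eq_inth, Nat.testBit_eq_inth, h']⟩

instance [InjectiveEncoding α] [InjectiveEncoding β] : InjectiveEncoding (α × β) where
  toEncoding := inferInstance
  enc_injective := by
    rintro ⟨x, x'⟩ ⟨y, y'⟩ h
    have h' : enc x = enc y ∧ enc x' = enc y' := Data.cons.inj h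
    rw [enc_injective h'.1, enc_injective h'.2]

instance [InjectiveEncoding α] : InjectiveEncoding (List α) where
  toEncoding := inferInstance
  enc_injective := by
    intro l l' h
    have h' : Data.ofList (l.map enc) = Data.ofList (l'.map enc) := h
    exact List.map_injective_iff.mpr enc_injective (Data.ofList_injective h')

namespace Feasible

variable [Context Γ]

theorem eq [InjectiveEncoding β] [DecidableEq β] {f g : Γ → β} (hf : Feasible f)
    (hg : Feasible g) : Feasible fun x => decide (f x = g x) := by
  obtain ⟨c, k, T, hT, hS, hc⟩ := hf.pair hg
  refine ⟨.seq c (.seq (.assign 1 (.cons (.var 0) .nil)) (.seq (.assign 2 (.cons .nil .nil))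
    (.seq compareLoop (.assign 0 (.var 2))))), k + 2,
    fun x => T x + ((enc (f x, g x)).size * 50 + 16),
    hT.add ((hS.mul (.const 50)).add (.const 16)),
    (PolyBounded.const 3).of_le fun x => size_enc_bool_le _, ?_⟩
  intro x s hs
  refine (Runs.seq ((hc x s hs).mono le_rfl ?_)).mono
    (T := T x + ((enc (f x, g x)).size * 50 + 15) + 1) (by dsimp only; omega) fun _ => _root_.id
  rintro s₁ ⟨h1, h2⟩
  refine (Runs.assign_seq (Runs.assign_seq (Runs.seq ((compareLoop_runs (enc (f x, g x)).size
    [(enc (f x), enc (g x))] ?_ true _ ?_ ?_).mono le_rfl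
      (Q' := fun s' => Runs (.assign 0 (.var 2)) s' 2 _) ?_)))).mono
    (by simp only [Expr.cost]; omega) fun _ h => h
  · simp only [stackSize, List.map_cons, List.map_nil, List.sum_cons, List.sum_nil, enc_pair,
      Data.size]
    omega
  · simp only [ne_eq, OfNat.one_ne_ofNat, not_false_eq_true, Function.update_of_ne,
      Function.update_self, Expr.eval, h1]
    rfl
  · simp [Expr.eval]
  · rintro s₂ ⟨h3, h4⟩
    refine Runs.assign ⟨?_, fun j hj => ?_⟩
    · simp only [Expr.eval, Function.update_self, h3]
      simp [enc_injective.eq_iff]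
    · rw [Function.update_of_ne (by omega), h4 j (by omega), Function.update_of_ne (by omega),
        Function.update_of_ne (by omega), h2 j (by omega)]

theorem isEmpty [Encoding α] {f : Γ → List α} (hf : Feasible f) :
    Feasible fun x => (f x).isEmpty := by
  obtain ⟨c, k, T, hT, hS, hc⟩ := hf
  refine ⟨.seq c (.ite (.var 0) (.assign 0 .nil) (.assign 0 (.cons .nil .nil))), k,
    fun x => T x + 7, hT.add (.const 7), (PolyBounded.const 3).of_le fun x => size_enc_bool_le _, ?_⟩
  intro x s hs
  refine Runs.seq (T₂ := 6) ((hc x s hs).mono le_rfl ?_)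
  rintro s₁ ⟨h1, h2⟩
  have upd : ∀ (d : Data) (j : ℕ), k < j → Function.update s₁ 0 d j = s j := fun d j hj => by
    rw [Function.update_of_ne (by omega), h2 j hj]
  cases hl : f x with
  | nil =>
    exact (Runs.ite_false (by simp [Expr.eval, h1, hl]) (Runs.assign
      ⟨by simp [Expr.eval, hl], upd _⟩)).mono (by simp [Expr.cost]) fun _ => _root_.id
  | cons a l =>
    exact (Runs.ite_true (by simp [Expr.eval, h1, hl]) (Runs.assign
      ⟨by simp [Expr.eval, hl], upd _⟩)).mono (by simp [Expr.cost]) fun _ => _root_.id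

/-! ### Operations on lists -/

variable [Encoding α] [Encoding β]

/-- A left fold with a truth value as accumulator. -/
theorem foldl_bool {L : Γ → List α} {b₀ : Γ → Bool} {step : Γ → Bool → α → Bool}
    (hL : Feasible L) (hb₀ : Feasible b₀)
    (hstep : Feasible fun y : Γ × (Bool × α) => step y.1 y.2.1 y.2.2) :
    Feasible fun x => (L x).foldl (step x) (b₀ x) :=
  foldl (fun _ => 3) (.const 3) (fun _ _ _ => size_enc_bool_le _) hL hb₀ hstep

theorem any {L : Γ → List α} {g : Γ → α → Bool} (hL : Feasible L)
    (hg : Feasible fun y : Γ × α => g y.1 y.2) : Feasible fun x => (L x).any (g x) := by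
  have h : Feasible fun x => (L x).foldl (fun b a => b || g x a) false :=
    foldl_bool hL (const false) (var.fst.or (hg.comp_snd var.snd))
  have eq : ∀ x (l : List α) b, l.foldl (fun b a => b || g x a) b = (b || l.any (g x)) := by
    intro x l
    induction l with
    | nil => simp
    | cons a l ih => simp [ih, Bool.or_assoc]
  simpa [eq] using h

theorem reverse {L : Γ → List α} (hL : Feasible L) : Feasible fun x => (L x).reverse := by
  have eq : ∀ l : List α, l.foldl (fun b a => a :: b) [] = l.reverse := fun l => by simp
  have h : Feasible fun x => (L x).foldl (fun b a => a :: b) [] := by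
    refine foldl (fun x => (enc (L x)).size * ((enc (L x)).size + 1) + 1)
      ((hL.size_bound.mul (hL.size_bound.add (.const 1))).add (.const 1)) ?_ hL (const [])
      (var.snd.cons var.fst)
    intro x l hl
    rw [eq]
    refine (size_enc_list_le (M := (enc (L x)).size) fun a ha =>
      size_enc_le_of_mem (hl.subset (List.mem_reverse.mp ha))).trans ?_
    rw [List.length_reverse]
    exact Nat.add_le_add_right
      (Nat.mul_le_mul_right _ (hl.length_le.trans (length_le_size_enc _))) 1
  simpa only [eq] using h

theorem append {L L' : Γ → List α} (hL : Feasible L) (hL' : Feasible L') :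
    Feasible fun x => L x ++ L' x := by
  have eq : ∀ l l' : List α, l.foldl (fun b a => a :: b) l' = l.reverse ++ l' := fun l l' => by
    simp
  have h : Feasible fun x => (L x).reverse.foldl (fun b a => a :: b) (L' x) := by
    refine foldl (fun x => (enc (L x)).size * ((enc (L x)).size + 1) + 1 + (enc (L' x)).size)
      (((hL.size_bound.mul (hL.size_bound.add (.const 1))).add (.const 1)).add hL'.size_bound)
      ?_ hL.reverse hL' (var.snd.cons var.fst)
    intro x l hl
    rw [eq]
    have h1 : (enc l.reverse).size ≤ l.reverse.length * ((enc (L x)).size + 1) + 1 :=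
      size_enc_list_le fun a ha => size_enc_le_of_mem
        (List.mem_reverse.mp (hl.subset (List.mem_reverse.mp ha)))
    have h2 := size_enc_append l.reverse (L' x)
    have h3 : l.reverse.length ≤ (enc (L x)).size := by
      have := hl.length_le
      rw [List.length_reverse] at this ⊢
      exact this.trans (length_le_size_enc _)
    have h4 := Nat.mul_le_mul_right ((enc (L x)).size + 1) h3
    omega
  simpa only [eq, List.reverse_reverse] using h

theorem flatMap {L : Γ → List α} {g : Γ → α → List β} (hL : Feasible L)
    (hg : Feasible fun y : Γ × α => g y.1 y.2) : Feasible fun x => (L x).flatMap (g x) := by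
  have eq : ∀ x (l : List α) b, l.foldl (fun b a => b ++ g x a) b = b ++ l.flatMap (g x) := by
    intro x l
    induction l with
    | nil => simp
    | cons a l ih => simp [ih]
  have h : Feasible fun x => (L x).foldl (fun b a => b ++ g x a) [] := by
    obtain ⟨d, hd⟩ := hg.size_bound
    refine foldl (fun x => (enc (L x)).size * (weight x + ((enc (L x)).size + 1) + 2) ^ d + 1)
      ((hL.size_bound.mul (((PolyBounded.self.add (hL.size_bound.add (.const 1))).add
        (.const 2)).pow d)).add (.const 1)) ?_ hL (const []) (var.fst.append (hg.comp_snd var.snd))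
    intro x l hl
    rw [eq, List.nil_append]
    set M := (weight x + ((enc (L x)).size + 1) + 2) ^ d
    have hM : ∀ a ∈ l, (enc (g x a)).size ≤ M := fun a ha =>
      (hd (x, a)).trans (Nat.pow_le_pow_left (by
        have := size_enc_le_of_mem (hl.subset ha)
        rw [weight_pair]
        omega) d)
    have key : (enc (l.flatMap (g x))).size ≤ l.length * M + 1 := by
      clear hl
      induction l with
      | nil => simp [Data.size]
      | cons a l ih =>
        have h1 := ih fun a ha => hM a (List.mem_cons_of_mem _ ha)
        have h2 := hM a List.mem_cons_self
        have h3 := size_enc_append (g x a) (l.flatMap (g x))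
        simp only [List.flatMap_cons, List.length_cons, Nat.succ_mul]
        omega
    exact key.trans (Nat.add_le_add_right
      (Nat.mul_le_mul_right _ (hl.length_le.trans (length_le_size_enc _))) 1)
  simpa only [eq, List.nil_append] using h

theorem map {L : Γ → List α} {g : Γ → α → β} (hL : Feasible L)
    (hg : Feasible fun y : Γ × α => g y.1 y.2) : Feasible fun x => (L x).map (g x) := by
  simpa only [← List.map_eq_flatMap] using hL.flatMap (g := fun x a => [g x a]) (hg.cons (const []))

theorem filter {L : Γ → List α} {g : Γ → α → Bool} (hL : Feasible L)
    (hg : Feasible fun y : Γ × α => g y.1 y.2) : Feasible fun x => (L x).filter (g x) := by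
  have eq : ∀ x (l : List α), l.flatMap (fun a => if g x a then [a] else []) = l.filter (g x) := by
    intro x l
    induction l with
    | nil => rfl
    | cons a l ih => by_cases h : g x a <;> simp [ih, h]
  simpa only [eq] using hL.flatMap (g := fun x a => if g x a then [a] else [])
    (hg.ite (var.cons (const [])) (const []))

theorem drop_length {L : Γ → List α} {L' : Γ → List β} (hL : Feasible L) (hL' : Feasible L') :
    Feasible fun x => (L' x).drop (L x).length := by
  have eq : ∀ (l : List α) (l' : List β), l.foldl (fun b _ => b.tail) l' = l'.drop l.length := by
    intro l
    induction l with
    | nil => simp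
    | cons a l ih => intro l'; simp [ih]
  have h : Feasible fun x => (L x).foldl (fun b _ => b.tail) (L' x) := by
    refine foldl (fun x => (enc (L' x)).size * ((enc (L' x)).size + 1) + 1)
      ((hL'.size_bound.mul (hL'.size_bound.add (.const 1))).add (.const 1)) ?_ hL hL' var.fst.tail
    intro x l hl
    rw [eq]
    refine (size_enc_list_le (M := (enc (L' x)).size) fun a ha =>
      size_enc_le_of_mem (List.mem_of_mem_drop ha)).trans ?_
    exact Nat.add_le_add_right (Nat.mul_le_mul_right _
      ((by simp : _ ≤ (L' x).length).trans (length_le_size_enc _))) 1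
  simpa only [eq] using h

theorem length_lt {L : Γ → List α} {L' : Γ → List β} (hL : Feasible L) (hL' : Feasible L') :
    Feasible fun x => decide ((L x).length < (L' x).length) := by
  refine cast (congrArg _ (funext fun x => ?_)) (hL.drop_length hL').isEmpty.not
  rw [Bool.eq_iff_iff]
  simp

end Feasible

/-- The distinct elements of a list. -/
def distinct [DecidableEq α] (l : List α) : List α :=
  l.foldl (fun acc x => if acc.any fun y => decide (y = x) then acc else x :: acc) []

section distinct

variable [DecidableEq α]

theorem distinct_append_singleton (l : List α) (x : α) :
    distinct (l ++ [x]) = if x ∈ distinct l then distinct l else x :: distinct l := by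
  simp [distinct]

theorem mem_distinct {l : List α} {x : α} : x ∈ distinct l ↔ x ∈ l := by
  induction l using List.reverseRecOn with
  | nil => simp [distinct]
  | append_singleton l y ih =>
    rw [distinct_append_singleton]
    split_ifs with h
    · rw [List.mem_append, List.mem_singleton, ih]
      exact ⟨Or.inl, fun hx => hx.elim id fun hx => ih.mp (hx ▸ h)⟩
    · simp [ih, or_comm]

theorem nodup_distinct (l : List α) : (distinct l).Nodup := by
  induction l using List.reverseRecOn with
  | nil => simp [distinct]
  | append_singleton l y ih =>
    rw [distinct_append_singleton]
    split_ifs with h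
    · exact ih
    · exact List.nodup_cons.mpr ⟨h, ih⟩

theorem length_distinct_le (l : List α) : (distinct l).length ≤ l.length := by
  induction l using List.reverseRecOn with
  | nil => simp [distinct]
  | append_singleton l y ih =>
    rw [distinct_append_singleton]
    split_ifs with h <;> simp <;> omega

theorem Feasible.distinct [Context Γ] [InjectiveEncoding α] {L : Γ → List α} (hL : Feasible L) :
    Feasible fun x => distinct (L x) := by
  refine foldl (fun x => (enc (L x)).size * ((enc (L x)).size + 1) + 1)
    ((hL.size_bound.mul (hL.size_bound.add (.const 1))).add (.const 1)) ?_ hL (const []) ?_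
  · intro x l hl
    refine (size_enc_list_le (l := WhileLang.distinct l) (M := (enc (L x)).size) fun a ha =>
      size_enc_le_of_mem (hl.subset (mem_distinct.mp ha))).trans ?_
    exact Nat.add_le_add_right (Nat.mul_le_mul_right _
      ((length_distinct_le l).trans (hl.length_le.trans (length_le_size_enc _)))) 1
  · exact (var.fst.any (var.eq var.weaken.snd)).ite var.fst (var.snd.cons var.fst)

end distinct

end WhileLang

/-! ### The dynamic program -/

namespace NPInstance

open WhileLang
open Encoding (enc)
open Context (weight)

/-- The size of the input, multiplied by `2 ^ τ` for `τ` voter types. -/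
noncomputable instance : Context NPInstance where
  enc := encode
  weight I := I.encode.size * 2 ^ I.election.numTypes
  size_le _ := Nat.le_mul_of_pos_right _ (Nat.two_pow_pos _)

/-- The numbers of all candidates, each with the number of its party. -/
def candidates (I : NPInstance) : List (ℕ × ℕ) := List.ofFn fun c => ((c : ℕ), (I.party c : ℕ))

/-- The preference lists of all voters. -/
def ballots (I : NPInstance) : List (List ℕ) :=
  List.ofFn fun v => List.ofFn fun i => (I.ballot v i : ℕ)

/-- Whether `d` stands before `c` in the list `b`. -/
def before (b : List ℕ) (d c : ℕ) : Bool :=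
  b.foldr (fun x r => if x = c then false else if x = d then true else r) false

/-- What the choices made so far imply for two fixed candidates `p` and `c`: for each voter, the
preference list with the tails of the scoring vector that start at the current positions of `p` and
of `c`. Scores are written in unary, as lists without content. -/
abbrev State := List (List ℕ × (List (List Unit) × List (List Unit)))

/-- The state before any party has chosen its nominee. -/
def start (A : List (List Unit)) (bs : List (List ℕ)) : State := bs.map fun b => (b, A, A)

/-- The state after the nomination of `d`. -/
def advance (p c d : ℕ) (s : State) : State :=
  s.map fun y => (y.1, (if before y.1 d p then y.2.1.tail else y.2.1),
    (if before y.1 d c then y.2.2.tail else y.2.2))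

/-- The candidates that party `j` may nominate if the parties of `q` and `e` have to nominate `q`
and `e`; candidates are given with their parties. -/
def options (cands : List (ℕ × ℕ)) (q e : ℕ × ℕ) (j : ℕ) : List ℕ :=
  (cands.filter fun x => decide (x.2 = j) &&
    ((!decide (x.2 = q.2) || decide (x.1 = q.1)) &&
      (!decide (x.2 = e.2) || decide (x.1 = e.1)))).map fun x => x.1

/-- The states that arise from those in `S` when one of the candidates in `ds` is nominated. -/
def expand (p c : ℕ) (ds : List ℕ) (S : List State) : List State :=
  distinct (S.flatMap fun s => ds.map fun d => advance p c d s)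

/-- The states that can be reached when the parties in `js` choose their nominees. -/
def reachable (A : List (List Unit)) (bs : List (List ℕ)) (cands : List (ℕ × ℕ)) (q e : ℕ × ℕ)
    (js : List ℕ) : List State :=
  js.foldl (fun S j => expand q.1 e.1 (options cands q e j) S) [start A bs]

/-- Whether the second of the two candidates that a state follows has the greater score. -/
def overtaken (s : State) : Bool :=
  decide ((s.flatMap fun y => y.2.1.headD []).length < (s.flatMap fun y => y.2.2.headD []).length)

/-- The answer of the dynamic program: it looks up the distinguished candidate `q` with its party,
and for no candidate `e` can a state be reached in which `e` has a greater score than `q`. -/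
def alwaysWins (A : List (List Unit)) (I : NPInstance) : Bool :=
  !(I.candidates.any fun q => decide (q.1 = (I.p : ℕ)) && I.candidates.any fun e =>
    (reachable A I.ballots I.candidates q e (distinct (I.candidates.map fun x => x.2))).any
      fun s => overtaken s)

/-! ### Correctness of the transitions -/

theorem before_map {α : Type} {r : α → α → Prop} [Std.Irrefl r] [Std.Asymm r] {f : α → ℕ}
    (hf : Function.Injective f) {l : List α} (hl : l.Pairwise r) {d c : α} (hd : d ∈ l)
    (hc : c ∈ l) : before (l.map f) (f d) (f c) = true ↔ r d c := by
  induction l with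
  | nil => cases hd
  | cons x l ih =>
    obtain ⟨hx, hl⟩ := List.pairwise_cons.mp hl
    simp only [before, List.map_cons, List.foldr_cons] at ih ⊢
    by_cases hxc : x = c
    · subst hxc
      have : ¬ r d x := by
        rcases List.mem_cons.mp hd with rfl | hd
        · exact irrefl d
        · exact asymm (hx d hd)
      simpa using this
    · have hc' : c ∈ l := (List.mem_cons.mp hc).resolve_left (Ne.symm hxc)
      rw [if_neg (hf.ne hxc)]
      by_cases hxd : x = d
      · subst hxd
        simpa using hx c hc'
      · rw [if_neg (hf.ne hxd)]
        exact ih hl ((List.mem_cons.mp hd).resolve_left (Ne.symm hxd)) hc'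

theorem before_ballot (I : NPInstance) (v : Fin I.m) (d c : Fin I.n) :
    before (List.ofFn fun i => (I.ballot v i : ℕ)) d c = true ↔
      (I.ballot v).symm d < (I.ballot v).symm c := by
  have h : (List.ofFn fun i => (I.ballot v i : ℕ)) = (List.ofFn (I.ballot v)).map Fin.val := by
    rw [List.map_ofFn]
    rfl
  have hmem : ∀ x, x ∈ List.ofFn (I.ballot v) := fun x =>
    List.mem_ofFn.mpr ⟨(I.ballot v).symm x, by simp⟩
  rw [h]
  have : Std.Irrefl fun x y => (I.ballot v).symm x < (I.ballot v).symm y := ⟨fun _ => lt_irrefl _⟩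
  have : Std.Asymm fun x y => (I.ballot v).symm x < (I.ballot v).symm y := ⟨fun _ _ => lt_asymm⟩
  exact before_map (r := fun x y => (I.ballot v).symm x < (I.ballot v).symm y) Fin.val_injective
    (List.pairwise_ofFn.mpr fun i j hij => by simpa using hij) (hmem d) (hmem c)

/-- The state after the candidates in `ds` have been nominated. -/
def outcome (A : List (List Unit)) (bs : List (List ℕ)) (p c : ℕ) (ds : List ℕ) : State :=
  bs.map fun b => (b, A.drop (ds.countP fun d => before b d p),
    A.drop (ds.countP fun d => before b d c))

theorem foldl_advance_start (A : List (List Unit)) (bs : List (List ℕ)) (p c : ℕ) (ds : List ℕ) :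
    ds.foldl (fun s d => advance p c d s) (start A bs) = outcome A bs p c ds := by
  induction ds using List.reverseRecOn with
  | nil => simp [start, outcome]
  | append_singleton ds d ih =>
    rw [List.foldl_append, ih]
    simp only [List.foldl_cons, List.foldl_nil, advance, outcome, List.map_map]
    refine List.map_congr_left fun b _ => ?_
    simp only [Function.comp_apply, List.countP_append, List.countP_cons, List.countP_nil, zero_add]
    cases before b d p <;> cases before b d c <;> simp

/-- The deduplicated sets contain exactly the states that some sequence of choices produces. -/
theorem mem_foldl_expand {p c : ℕ} {opt : ℕ → List ℕ} {js : List ℕ} {S : List State} {s : State} :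
    s ∈ js.foldl (fun S j => expand p c (opt j) S) S ↔
      ∃ s₀ ∈ S, ∃ ds, List.Forall₂ (fun d j => d ∈ opt j) ds js ∧
        s = ds.foldl (fun s d => advance p c d s) s₀ := by
  induction js generalizing S with
  | nil => simp
  | cons j js ih =>
    rw [List.foldl_cons, ih]
    constructor
    · rintro ⟨s₁, hs₁, ds, hds, rfl⟩
      simp only [expand, mem_distinct, List.mem_flatMap, List.mem_map] at hs₁
      obtain ⟨s₀, hs₀, d, hd, rfl⟩ := hs₁
      exact ⟨s₀, hs₀, d :: ds, .cons hd hds, rfl⟩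
    · rintro ⟨s₀, hs₀, _, hds, rfl⟩
      cases hds with
      | cons hd hds =>
        refine ⟨_, ?_, _, hds, rfl⟩
        simp only [expand, mem_distinct, List.mem_flatMap, List.mem_map]
        exact ⟨s₀, hs₀, _, hd, rfl⟩

theorem mem_reachable {A : List (List Unit)} {bs : List (List ℕ)} {cands : List (ℕ × ℕ)}
    {q e : ℕ × ℕ} {js : List ℕ} {s : State} :
    s ∈ reachable A bs cands q e js ↔
      ∃ ds, List.Forall₂ (fun d j => d ∈ options cands q e j) ds js ∧
        s = outcome A bs q.1 e.1 ds := by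
  simp [reachable, mem_foldl_expand, foldl_advance_start]

theorem mem_options {I : NPInstance} {p c : Fin I.n} {j : Fin I.t} {d : ℕ} :
    d ∈ options I.candidates (p, I.party p) (c, I.party c) j ↔
      ∃ x : Fin I.n, (x : ℕ) = d ∧ I.party x = j ∧ (I.party x = I.party p → x = p) ∧
        (I.party x = I.party c → x = c) := by
  simp only [options, candidates, List.mem_map, List.mem_filter, List.mem_ofFn, Bool.and_eq_true,
    Bool.or_eq_true, Bool.not_eq_true', decide_eq_true_eq, decide_eq_false_iff_not]
  constructor
  · rintro ⟨_, ⟨⟨x, rfl⟩, h1, h2, h3⟩, rfl⟩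
    exact ⟨x, rfl, Fin.ext h1, fun h => Fin.ext (h2.resolve_left (not_not.mpr (congrArg Fin.val h))),
      fun h => Fin.ext (h3.resolve_left (not_not.mpr (congrArg Fin.val h)))⟩
  · rintro ⟨x, rfl, rfl, h2, h3⟩
    refine ⟨_, ⟨⟨x, rfl⟩, rfl, ?_, ?_⟩, rfl⟩
    · by_cases h : I.party x = I.party p
      · exact .inr (congrArg Fin.val (h2 h))
      · exact .inl fun h' => h (Fin.ext h')
    · by_cases h : I.party x = I.party c
      · exact .inr (congrArg Fin.val (h3 h))
      · exact .inl fun h' => h (Fin.ext h')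

theorem exists_eq_map_of_forall₂ {ι α : Type} [DecidableEq ι] [Nonempty α] {R : α → ι → Prop}
    {l : List ι} (hl : l.Nodup) {l' : List α} (h : List.Forall₂ R l' l) :
    ∃ g : ι → α, l' = l.map g ∧ ∀ j ∈ l, R (g j) j := by
  induction h with
  | nil => exact ⟨fun _ => Classical.arbitrary α, by simp⟩
  | @cons a j l' l ha h ih =>
    obtain ⟨hj, hl⟩ := List.nodup_cons.mp hl
    obtain ⟨g, rfl, hg⟩ := ih hl
    have hne : ∀ i ∈ l, i ≠ j := fun i hi h => hj (h ▸ hi)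
    refine ⟨Function.update g j a, ?_, ?_⟩
    · simp only [List.map_cons, Function.update_self, List.cons.injEq, true_and]
      exact List.map_congr_left fun i hi => by rw [Function.update_of_ne (hne i hi)]
    · intro i hi
      rcases List.mem_cons.mp hi with rfl | hi
      · simpa using ha
      · rw [Function.update_of_ne (hne i hi)]
        exact hg i hi

/-- The list that the dynamic program goes through contains every party exactly once. -/
theorem exists_parties (I : NPInstance) : ∃ J : List (Fin I.t), J.Nodup ∧ (∀ j, j ∈ J) ∧
    distinct (I.candidates.map fun x => x.2) = J.map Fin.val := by
  have hmem : ∀ j, j ∈ distinct (I.candidates.map fun x => x.2) ↔ ∃ c, (I.party c : ℕ) = j := by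
    intro j
    simp [mem_distinct, candidates, List.mem_ofFn]
  have hnd := nodup_distinct (I.candidates.map fun x => x.2)
  generalize distinct (I.candidates.map fun x => x.2) = js at hmem hnd
  lift js to List (Fin I.t) using fun j hj => by
    obtain ⟨c, rfl⟩ := (hmem j).mp hj
    exact (I.party c).2
  refine ⟨js, hnd.of_map _, fun j => ?_, rfl⟩
  obtain ⟨c, rfl⟩ := I.party_surjective j
  exact (List.mem_map_of_injective Fin.val_injective).mp ((hmem _).mpr ⟨c, rfl⟩)

/-! ### Nominations as choice functions -/

/-- `g` selects a nominee of each party. -/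
def Selects (I : NPInstance) (g : Fin I.t → Fin I.n) : Prop := ∀ j, I.party (g j) = j

/-- The number of nominees that voter `v` prefers to `c`. -/
def rank (I : NPInstance) (g : Fin I.t → Fin I.n) (v : Fin I.m) (c : Fin I.n) : ℕ :=
  (Finset.univ.filter fun j => (I.ballot v).symm (g j) < (I.ballot v).symm c).card

theorem position_reduced {I : NPInstance} {g : Fin I.t → Fin I.n} (hg : I.Selects g)
    (v : Fin I.m) (c : Finset.univ.image g) :
    (I.election.reduced (Finset.univ.image g)).position v c = I.rank g v c := by
  have hinj : Function.Injective g := Function.LeftInverse.injective hg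
  rw [Election.position, ← Set.ncard_image_of_injective _ Subtype.val_injective, rank,
    ← Finset.card_image_of_injective _ hinj, ← Set.ncard_coe_finset]
  congr 1
  ext x
  simp only [Election.reduced, election, Set.mem_image, Set.mem_ofPred_eq, Finset.coe_image,
    Finset.coe_filter, Finset.mem_univ, true_and]
  constructor
  · rintro ⟨⟨y, hy⟩, h, rfl⟩
    obtain ⟨j, -, rfl⟩ := Finset.mem_image.mp hy
    exact ⟨j, h, rfl⟩
  · rintro ⟨j, h, rfl⟩
    exact ⟨⟨g j, Finset.mem_image_of_mem g (Finset.mem_univ j)⟩, h, rfl⟩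

theorem isNomination_image {I : NPInstance} {g : Fin I.t → Fin I.n} (hg : I.Selects g) :
    I.IsNomination (Finset.univ.image g) := by
  refine fun j => ⟨g j, ⟨Finset.mem_image_of_mem g (Finset.mem_univ j), hg j⟩, ?_⟩
  rintro y ⟨hy, rfl⟩
  obtain ⟨i, -, rfl⟩ := Finset.mem_image.mp hy
  rw [hg i]

theorem IsNomination.exists_selects {I : NPInstance} {C' : Finset (Fin I.n)}
    (h : I.IsNomination C') : ∃ g, I.Selects g ∧ C' = Finset.univ.image g := by
  choose g hg huniq using h
  refine ⟨g, fun j => (hg j).2, ?_⟩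
  ext x
  simp only [Finset.mem_image, Finset.mem_univ, true_and]
  constructor
  · exact fun hx => ⟨I.party x, (huniq _ x ⟨hx, rfl⟩).symm⟩
  · rintro ⟨j, rfl⟩
    exact (hg j).1

theorem Selects.apply_party {I : NPInstance} {g : Fin I.t → Fin I.n} (hg : I.Selects g)
    {c : Fin I.n} (hc : c ∈ Finset.univ.image g) : g (I.party c) = c := by
  obtain ⟨j, -, rfl⟩ := Finset.mem_image.mp hc
  rw [hg j]

theorem isNecessaryPresident_iff (I : NPInstance) (w : ℕ → ℚ) :
    I.IsNecessaryPresident (scoringRule w) ↔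
      ∀ g, I.Selects g → g (I.party I.p) = I.p → ∀ c, g (I.party c) = c →
        ∑ v, w (I.rank g v c) ≤ ∑ v, w (I.rank g v I.p) := by
  constructor
  · intro h g hg hp c hc
    have hp' : I.p ∈ Finset.univ.image g := hp ▸ Finset.mem_image_of_mem g (Finset.mem_univ _)
    have hc' : c ∈ Finset.univ.image g := hc ▸ Finset.mem_image_of_mem g (Finset.mem_univ _)
    have := h _ hp' (isNomination_image hg) ⟨c, hc'⟩
    simpa only [Election.score, position_reduced hg] using this
  · rintro h C' hp hC' ⟨c, hc⟩
    obtain ⟨g, hg, rfl⟩ := hC'.exists_selects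
    simp only [Election.score, position_reduced hg]
    exact h g hg (hg.apply_party hp) c (hg.apply_party hc)

/-! ### Correctness of the dynamic program -/

theorem countP_before {I : NPInstance} {J : List (Fin I.t)} (hJ : J.Nodup) (hJ' : ∀ j, j ∈ J)
    (g : Fin I.t → Fin I.n) (v : Fin I.m) (c : Fin I.n) :
    (J.map fun j => (g j : ℕ)).countP
        (fun d => before (List.ofFn fun i => (I.ballot v i : ℕ)) d c) = I.rank g v c := by
  rw [List.countP_map, List.countP_eq_length_filter, rank,
    ← List.toFinset_card_of_nodup (hJ.filter _)]
  congr 1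
  ext j
  simp [hJ', before_ballot]

/-- The score of `c`, computed from the unary scoring vector `A`. -/
def points (A : List (List Unit)) (I : NPInstance) (g : Fin I.t → Fin I.n) (c : Fin I.n) : ℕ :=
  ∑ v, ((A.drop (I.rank g v c)).headD []).length

theorem overtaken_outcome {I : NPInstance} {J : List (Fin I.t)} (hJ : J.Nodup) (hJ' : ∀ j, j ∈ J)
    (A : List (List Unit)) (g : Fin I.t → Fin I.n) (p c : Fin I.n) :
    overtaken (outcome A I.ballots p c (J.map fun j => (g j : ℕ))) = true ↔
      points A I g p < points A I g c := by
  simp only [overtaken, outcome, ballots, List.map_ofFn, List.length_flatMap, decide_eq_true_eq,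
    List.sum_ofFn, Function.comp_apply, countP_before hJ hJ', points]

theorem alwaysWins_iff (A : List (List Unit)) (I : NPInstance) :
    alwaysWins A I = true ↔ ∀ g, I.Selects g → g (I.party I.p) = I.p →
      ∀ c, g (I.party c) = c → points A I g c ≤ points A I g I.p := by
  obtain ⟨J, hJ, hJ', hJs⟩ := I.exists_parties
  rw [alwaysWins, Bool.not_eq_true', ← Bool.not_eq_true, ← not_iff_not, not_not]
  simp only [not_forall, not_le, hJs, List.any_eq_true, Bool.and_eq_true, decide_eq_true_eq,
    mem_reachable]
  constructor
  · rintro ⟨q, hq, hqp, e, he, s, ⟨ds, hds, rfl⟩, hs⟩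
    obtain ⟨p, rfl⟩ := List.mem_ofFn.mp hq
    obtain rfl : p = I.p := Fin.ext hqp
    obtain ⟨c, rfl⟩ := List.mem_ofFn.mp he
    rw [List.forall₂_map_right_iff] at hds
    obtain ⟨g, rfl, hg⟩ := exists_eq_map_of_forall₂ hJ hds
    simp only [mem_options] at hg
    choose g' hg' hsel hp hc using fun j => hg j (hJ' j)
    obtain rfl : (fun j => (g' j : ℕ)) = g := funext hg'
    exact ⟨g', hsel, hp _ (hsel _), c, hc _ (hsel _), (overtaken_outcome hJ hJ' A g' _ c).mp hs⟩
  · rintro ⟨g, hg, hp, c, hc, h⟩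
    refine ⟨_, List.mem_ofFn.mpr ⟨I.p, rfl⟩, rfl, _, List.mem_ofFn.mpr ⟨c, rfl⟩, _,
      ⟨J.map fun j => (g j : ℕ), ?_, rfl⟩, (overtaken_outcome hJ hJ' A g _ c).mpr h⟩
    rw [List.forall₂_map_right_iff, List.forall₂_map_left_iff, List.forall₂_same]
    refine fun j _ => mem_options.mpr ⟨g j, rfl, hg j, ?_, ?_⟩
    · rw [hg j]
      rintro rfl
      exact hp
    · rw [hg j]
      rintro rfl
      exact hc

/-! ### The number and size of states -/

theorem ballot_eq_of_pref_eq {I : NPInstance} {v w : Fin I.m}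
    (h : I.election.pref v = I.election.pref w) : I.ballot v = I.ballot w := by
  have hlt : ∀ c d, (I.ballot v).symm c < (I.ballot v).symm d ↔
      (I.ballot w).symm c < (I.ballot w).symm d := fun c d => iff_of_eq (congrFun (congrFun h c) d)
  let φ : Fin I.n ≃o Fin I.n :=
    { toEquiv := (I.ballot v).trans (I.ballot w).symm
      map_rel_iff' := fun {a b} => by
        have := (hlt (I.ballot v b) (I.ballot v a)).not
        simpa using this.symm }
  have hφ : φ = OrderIso.refl _ := Subsingleton.elim _ _
  ext i
  have h1 : (I.ballot w).symm (I.ballot v i) = i := congrArg (fun ψ : _ ≃o _ => ψ i) hφ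
  rw [Equiv.symm_apply_eq] at h1
  rw [h1]

theorem card_ballots_le (I : NPInstance) : I.ballots.toFinset.card ≤ I.election.numTypes := by
  classical
  rw [Election.numTypes, ← Set.ncard_coe_finset]
  have hsurj : (I.ballots.toFinset : Set (List ℕ)) =
      Set.range fun v : Fin I.m => List.ofFn fun i => (I.ballot v i : ℕ) := by
    ext b
    simp [ballots, List.mem_ofFn]
  rw [hsurj]
  -- The preference list is a function of the preference relation.
  have hfac : ∀ r : Set.range I.election.pref, ∃ v, I.election.pref v = r := fun r => r.2
  choose rep hrep using hfac
  let F : Set.range I.election.pref → List ℕ := fun r => List.ofFn fun i => (I.ballot (rep r) i : ℕ)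
  have hle : (Set.range fun v : Fin I.m => List.ofFn fun i => (I.ballot v i : ℕ)) ⊆
      F '' Set.univ := by
    rintro _ ⟨v, rfl⟩
    refine ⟨⟨_, v, rfl⟩, trivial, ?_⟩
    simp only [F, ballot_eq_of_pref_eq (hrep ⟨_, v, rfl⟩)]
  refine (Set.ncard_le_ncard hle (Set.toFinite _)).trans
    ((Set.ncard_image_le (Set.toFinite _)).trans ?_)
  rw [Set.ncard_univ]
  exact (Nat.card_coe_set_eq _).le

/-- Distinct outcomes differ in the positions, cut off at the length of `A`, that the two fixed
candidates take in some of the distinct preference lists. -/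
theorem length_outcomes_le {A : List (List Unit)} {bs : List (List ℕ)} {p c : ℕ} {S : List State}
    (hS : S.Nodup) (h : ∀ s ∈ S, ∃ ds, s = outcome A bs p c ds) :
    S.length ≤ ((A.length + 1) * (A.length + 1)) ^ bs.toFinset.card := by
  classical
  let F : (bs.toFinset → Fin (A.length + 1) × Fin (A.length + 1)) → State := fun G =>
    bs.attach.map fun b => (b.1, A.drop (G ⟨b.1, List.mem_toFinset.mpr b.2⟩).1,
      A.drop (G ⟨b.1, List.mem_toFinset.mpr b.2⟩).2)
  have hsub : S.toFinset ⊆ Finset.univ.image F := by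
    intro s hs
    obtain ⟨ds, rfl⟩ := h s (List.mem_toFinset.mp hs)
    refine Finset.mem_image.mpr ⟨fun b =>
      (⟨min (ds.countP fun d => before b d p) A.length, by omega⟩,
        ⟨min (ds.countP fun d => before b d c) A.length, by omega⟩), Finset.mem_univ _, ?_⟩
    have hdrop : ∀ k, A.drop (min k A.length) = A.drop k := fun k => by
      rcases le_total k A.length with h | h
      · rw [min_eq_left h]
      · rw [min_eq_right h, List.drop_length, List.drop_of_length_le h]
    simp only [F, hdrop, outcome]
    exact List.attach_map_val (f := fun b => (b, A.drop (ds.countP fun d => before b d p),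
      A.drop (ds.countP fun d => before b d c)))
  rw [← List.toFinset_card_of_nodup hS]
  refine (Finset.card_le_card hsub).trans (Finset.card_image_le.trans (le_of_eq ?_))
  simp only [Finset.card_univ, Fintype.card_fun, Fintype.card_prod, Fintype.card_fin,
    Fintype.card_coe]

theorem size_enc_outcome_le (A : List (List Unit)) (bs : List (List ℕ)) (p c : ℕ) (ds : List ℕ) :
    (enc (outcome A bs p c ds)).size ≤
      (enc bs).size * ((enc bs).size + 2 * (enc A).size + 3) + 1 := by
  have hdrop : ∀ k, (enc (A.drop k)).size ≤ (enc A).size := fun k => by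
    have h1 := size_enc_append (A.take k) (A.drop k)
    have h2 : 0 < (enc (A.take k)).size := by
      cases enc (A.take k) <;> simp [Data.size]
    rw [List.take_append_drop] at h1
    omega
  refine (size_enc_list_le (M := (enc bs).size + 2 * (enc A).size + 2) fun y hy => ?_).trans ?_
  · obtain ⟨b, hb, rfl⟩ := List.mem_map.mp hy
    have h1 := size_enc_le_of_mem hb
    have h2 := hdrop (ds.countP fun d => before b d p)
    have h3 := hdrop (ds.countP fun d => before b d c)
    simp only [enc_pair, Data.size]
    omega
  · rw [outcome, List.length_map]
    exact Nat.add_le_add_right (Nat.mul_le_mul_right _ (length_le_size_enc _)) 1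

/-! ### Running time of the dynamic program -/

section feasible

variable {Γ : Type} [Context Γ]

theorem feasible_before {b : Γ → List ℕ} {d c : Γ → ℕ} (hb : Feasible b) (hd : Feasible d)
    (hc : Feasible c) : Feasible fun x => before (b x) (d x) (c x) := by
  have h : Feasible fun x => (b x).reverse.foldl (fun r y => if decide (y = c x) then false
      else if decide (y = d x) then true else r) false :=
    hb.reverse.foldl_bool (.const false) (.ite (.eq Feasible.var.snd hc.weaken) (.const false)
      (.ite (.eq Feasible.var.snd hd.weaken) (.const true) Feasible.var.fst))
  simpa only [List.foldl_reverse, decide_eq_true_eq, before] using h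

theorem feasible_advance {p c d : Γ → ℕ} {s : Γ → State} (hp : Feasible p) (hc : Feasible c)
    (hd : Feasible d) (hs : Feasible s) : Feasible fun x => advance (p x) (c x) (d x) (s x) := by
  have hb := Feasible.var (Γ := Γ) (α := List ℕ × (List (List Unit) × List (List Unit)))
  exact hs.map (hb.fst.pair
    ((Feasible.ite (feasible_before hb.fst hd.weaken hp.weaken) hb.snd.fst.tail hb.snd.fst).pair
      (Feasible.ite (feasible_before hb.fst hd.weaken hc.weaken) hb.snd.snd.tail hb.snd.snd)))

theorem feasible_options {cands : Γ → List (ℕ × ℕ)} {q e : Γ → ℕ × ℕ} {j : Γ → ℕ}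
    (hcands : Feasible cands) (hq : Feasible q) (he : Feasible e) (hj : Feasible j) :
    Feasible fun x => options (cands x) (q x) (e x) (j x) := by
  have hx := Feasible.var (Γ := Γ) (α := ℕ × ℕ)
  exact (hcands.filter ((hx.snd.eq hj.weaken).and
    (((hx.snd.eq hq.weaken.snd).not.or (hx.fst.eq hq.weaken.fst)).and
      ((hx.snd.eq he.weaken.snd).not.or (hx.fst.eq he.weaken.fst))))).map hx.fst

theorem feasible_expand {p c : Γ → ℕ} {ds : Γ → List ℕ} {S : Γ → List State} (hp : Feasible p)
    (hc : Feasible c) (hds : Feasible ds) (hS : Feasible S) :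
    Feasible fun x => expand (p x) (c x) (ds x) (S x) :=
  (hS.flatMap (hds.weaken.map
    (feasible_advance hp.weaken.weaken hc.weaken.weaken Feasible.var Feasible.var.weaken))).distinct

theorem feasible_overtaken {s : Γ → State} (hs : Feasible s) :
    Feasible fun x => overtaken (s x) :=
  (hs.flatMap Feasible.var.snd.fst.headD).length_lt (hs.flatMap Feasible.var.snd.snd.headD)

theorem feasible_start (A : List (List Unit)) {bs : Γ → List (List ℕ)} (hbs : Feasible bs) :
    Feasible fun x => start A (bs x) :=
  hbs.map (Feasible.var.pair (.const (A, A)))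

end feasible

theorem enc_eq (I : NPInstance) : enc I = enc ((I.p : ℕ), I.candidates, I.ballots) := by
  change I.encode = Data.cons _ (Data.cons (Data.ofList _) (Data.ofList _))
  simp only [encode, candidates, ballots, List.map_ofFn]
  congr 4
  funext v
  exact congrArg Data.ofList (by simp only [List.map_ofFn]; rfl)

theorem feasible_components :
    Feasible fun I : NPInstance => ((I.p : ℕ), I.candidates, I.ballots) :=
  Feasible.id.op _ (.var 0) (fun s I h => by rw [Expr.eval, h, enc_eq]) 0 fun I => by
    rw [← enc_eq]
    exact le_rfl

theorem feasible_candidates : Feasible candidates := feasible_components.snd.fst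

theorem feasible_ballots : Feasible ballots := feasible_components.snd.snd

/-- An instance with `τ` voter types has at most `(ℓ + 1) ^ (2 * τ)` reachable states, which is
polynomial in `2 ^ τ` for fixed `ℓ`. -/
theorem exists_size_reachable_le (A : List (List Unit)) :
    ∃ B : NPInstance → ℕ, PolyBounded weight B ∧ ∀ (I : NPInstance) (q e : ℕ × ℕ) (js : List ℕ),
      (enc (reachable A I.ballots I.candidates q e js)).size ≤ B I := by
  have hbs := feasible_ballots.size_bound
  let M : NPInstance → ℕ := fun I =>
    (enc I.ballots).size * ((enc I.ballots).size + 2 * (enc A).size + 3) + 1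
  have hM : PolyBounded weight M :=
    (hbs.mul ((hbs.add (.const _)).add (.const 3))).add (.const 1)
  refine ⟨fun I => (weight I ^ (2 * (A.length + 1)) + 1) * (M I + 1) + 1,
    ((((PolyBounded.self.pow _).add (.const 1)).mul (hM.add (.const 1))).add (.const 1)), ?_⟩
  intro I q e js
  have hout : ∀ s ∈ reachable A I.ballots I.candidates q e js,
      ∃ ds, s = outcome A I.ballots q.1 e.1 ds := fun s hs => by
    obtain ⟨ds, -, h⟩ := mem_reachable.mp hs
    exact ⟨ds, h⟩
  have hnd : (reachable A I.ballots I.candidates q e js).Nodup := by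
    induction js using List.reverseRecOn with
    | nil => simp [reachable]
    | append_singleton js j =>
      rw [reachable, List.foldl_append]
      exact nodup_distinct _
  refine (size_enc_list_le (M := M I) fun s hs => ?_).trans
    (Nat.add_le_add_right (Nat.mul_le_mul_right _ ?_) 1)
  · obtain ⟨ds, rfl⟩ := hout s hs
    exact size_enc_outcome_le _ _ _ _ _
  · refine le_trans ?_ (Nat.le_succ _)
    calc _ ≤ ((A.length + 1) * (A.length + 1)) ^ I.ballots.toFinset.card :=
          length_outcomes_le hnd hout
      _ ≤ ((A.length + 1) * (A.length + 1)) ^ I.election.numTypes :=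
          Nat.pow_le_pow_right (Nat.mul_pos (Nat.succ_pos _) (Nat.succ_pos _)) I.card_ballots_le
      _ ≤ (2 ^ (2 * (A.length + 1))) ^ I.election.numTypes := by
          refine Nat.pow_le_pow_left ?_ _
          rw [two_mul, pow_add]
          exact Nat.mul_le_mul Nat.lt_two_pow_self.le Nat.lt_two_pow_self.le
      _ = (2 ^ I.election.numTypes) ^ (2 * (A.length + 1)) := by
          rw [← pow_mul, ← pow_mul, Nat.mul_comm]
      _ ≤ weight I ^ (2 * (A.length + 1)) := by
          refine Nat.pow_le_pow_left (Nat.le_mul_of_pos_left _ ?_) _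
          cases I.encode <;> simp [Data.size]

theorem feasible_reachable (A : List (List Unit)) :
    Feasible fun y : (NPInstance × (ℕ × ℕ)) × (ℕ × ℕ) =>
      reachable A y.1.1.ballots y.1.1.candidates y.1.2 y.2
        (distinct (y.1.1.candidates.map fun x => x.2)) := by
  obtain ⟨B, hB, hle⟩ := exists_size_reachable_le A
  have hB' : PolyBounded weight fun y : (NPInstance × (ℕ × ℕ)) × (ℕ × ℕ) => B y.1.1 :=
    hB.comp ((Feasible.polyBounded_weight_fst (Γ := NPInstance) (α := ℕ × ℕ)).comp
      Feasible.polyBounded_weight_fst)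
  have hc := feasible_candidates.weaken (α := ℕ × ℕ) |>.weaken (α := ℕ × ℕ)
  have hq := (Feasible.var (Γ := NPInstance) (α := ℕ × ℕ)).weaken (α := ℕ × ℕ)
  have he := Feasible.var (Γ := NPInstance × (ℕ × ℕ)) (α := ℕ × ℕ)
  exact Feasible.foldl (fun y => B y.1.1) hB' (fun y l _ => hle _ _ _ l)
    (hc.map Feasible.var.snd).distinct
    ((feasible_start A feasible_ballots).weaken.weaken.cons (.const []))
    (feasible_expand hq.weaken.fst he.weaken.fst
      (feasible_options hc.weaken hq.weaken he.weaken Feasible.var.snd) Feasible.var.fst)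

theorem feasible_alwaysWins (A : List (List Unit)) : Feasible (alwaysWins A) :=
  (feasible_candidates.any ((Feasible.var.fst.eq feasible_components.fst.weaken).and
    (feasible_candidates.weaken.any
      ((feasible_reachable A).any (feasible_overtaken Feasible.var))))).not

end NPInstance

/-! ### From feasible decision functions to fixed-parameter tractability -/

/-- A common denominator turns the scores into numbers of points, written in unary. -/
theorem exists_unary_scores {l : ℕ} (a : Fin l → ℚ) (ha : ∀ i, 0 ≤ a i) :
    ∃ (A : List (List Unit)) (D : ℚ), 0 < D ∧
      ∀ i, (((A.drop i).headD []).length : ℚ) = shortVector a i * D := by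
  have hden : ∀ i, ∃ k : ℕ, (k : ℚ) = a i * ∏ j, ((a j).den : ℚ) := fun i => by
    refine ⟨(a i).num.toNat * ∏ j ∈ Finset.univ.erase i, (a j).den, ?_⟩
    have hnum : (((a i).num.toNat : ℤ) : ℚ) = (a i).num := by
      rw [Int.toNat_of_nonneg (Rat.num_nonneg.mpr (ha i))]
    rw [← Finset.mul_prod_erase Finset.univ _ (Finset.mem_univ i), ← mul_assoc, Rat.mul_den_eq_num]
    push_cast at hnum ⊢
    rw [hnum]
  choose k hk using hden
  refine ⟨List.ofFn fun i => List.replicate (k i) (), ∏ j, ((a j).den : ℚ),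
    Finset.prod_pos fun j _ => Nat.cast_pos.mpr (a j).den_pos, fun i => ?_⟩
  rw [List.headD_eq_head?_getD, List.head?_drop, shortVector]
  split_ifs with h
  · simp [h, hk]
  · simp [h]

/-- The factor `3 * 2 ^ τ` comes from `|I| * 2 ^ τ + 2 ≤ 3 * 2 ^ τ * |I|`. -/
theorem computable_const_mul_two_pow_pow (d : ℕ) : Computable fun k : ℕ => (3 * 2 ^ k) ^ d := by
  have h2 : Primrec fun k : ℕ => 2 ^ k :=
    (Primrec.nat_rec₁ 1 (Primrec.nat_mul.comp₂ Primrec₂.right (Primrec₂.const 2))).of_eq fun k => by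
      induction k with
      | zero => rfl
      | succ k ih => exact congrArg (· * 2) ih
  have h3 : Primrec fun k : ℕ => 3 * 2 ^ k := Primrec.nat_mul.comp (Primrec.const 3) h2
  suffices Primrec fun k : ℕ => (3 * 2 ^ k) ^ d from this.to_comp
  induction d with
  | zero => simpa using Primrec.const 1
  | succ d ih => simpa only [pow_succ] using Primrec.nat_mul.comp ih h3

theorem theorem6 (l : ℕ) (hl : 1 ≤ l) (a : Fin l → ℚ) (ha : Antitone a)
    (hpos : 0 < a ⟨l - 1, Nat.sub_lt hl Nat.one_pos⟩) :
    (necessaryPresidentByTypes (scoringRule (shortVector a))).IsFPT := by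
  have hnonneg : ∀ i, 0 ≤ a i := fun i => hpos.le.trans (ha (by
    rw [Fin.le_def]
    have := i.2
    change (i : ℕ) ≤ l - 1
    omega))
  obtain ⟨A, D, hD, hA⟩ := exists_unary_scores a hnonneg
  obtain ⟨c, k, T, ⟨d, hT⟩, -, hc⟩ := NPInstance.feasible_alwaysWins A
  refine ⟨c, fun τ => (3 * 2 ^ τ) ^ d, d, computable_const_mul_two_pow_pow d, fun I => ?_⟩
  change NPInstance at I
  obtain ⟨s', t, he, ht, hs', -⟩ := hc I (WhileLang.inputStore I.encode) (by
    rw [WhileLang.inputStore, Function.update_self]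
    rfl)
  refine ⟨s', t, he, ht.trans ((hT I).trans ?_), ?_⟩
  · change (I.encode.size * 2 ^ I.election.numTypes + 2) ^ d ≤
      (3 * 2 ^ I.election.numTypes) ^ d * I.encode.size ^ d
    rw [← mul_pow]
    refine Nat.pow_le_pow_left ?_ d
    have h1 : 0 < I.encode.size := by
      cases I.encode <;> simp [WhileLang.Data.size]
    have h2 := Nat.mul_pos h1 (Nat.two_pow_pos I.election.numTypes)
    linarith [Nat.mul_comm I.encode.size (2 ^ I.election.numTypes)]
  · have hne : s' 0 ≠ WhileLang.Data.nil ↔ NPInstance.alwaysWins A I = true := by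
      rw [hs']
      cases NPInstance.alwaysWins A I <;> simp
    rw [hne, NPInstance.alwaysWins_iff]
    refine Iff.trans ?_ (NPInstance.isNecessaryPresident_iff I (shortVector a)).symm
    have hpoints : ∀ g x, (NPInstance.points A I g x : ℚ) =
        (∑ v, shortVector a (I.rank g v x)) * D := fun g x => by
      rw [NPInstance.points, Finset.sum_mul]
      push_cast
      exact Finset.sum_congr rfl fun v _ => hA _
    refine forall_congr' fun g => forall_congr' fun _ => forall_congr' fun _ =>
      forall_congr' fun x => forall_congr' fun _ => ?_
    rw [← Nat.cast_le (α := ℚ), hpoints, hpoints, mul_le_mul_iff_left₀ hD]
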